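/- Let $\zeta_7$ be a primitive seventh root of unity in $\mathbb{C}$, let $K=\mathbb{Q}(\zeta_7+\zeta_7^{-1})\subset\mathbb{R}$ with ring of integers $\mathcal{O}_K$, and put $\rho_7=2-(\zeta_7+\zeta_7^{-1})\in\mathcal{O}_K$. Let $\mathcal{O}_K^+$ denote the set of totally positive elements of $\mathcal{O}_K$, i.e. those $a\in\mathcal{O}_K$ with $\sigma(a)>0$ for every embedding $\sigma:K\hookrightarrow\mathbb{R}$. Consider the quadratic form $$Q(x,y,z,w)=x^2+xy+y^2+z^2+zw+w^2,$$ and say that $Q$ represents $a\in\mathcal{O}_K$ if $Q(x,y,z,w)=a$ for some $x,y,z,w\in\mathcal{O}_K$. In Hamilton's quaternions, with the norm $N(a+bi+cj+dk)=a^2+b^2+c^2+d^2$, put $\alpha=\frac{1+i\sqrt3}{2}$ and $\beta=j$, let $H$ be the ring $\{x+y\alpha+z\beta+w\alpha\beta : x,y,z,w\in\mathcal{O}_K\}$, so that $N(x+y\alpha+z\beta+w\alpha\beta)=Q(x,y,z,w)$, and let $S=H(1+\alpha+2\beta)+H\rho_7$, a left ideal of $H$. **Theorem.** Let $\theta\in\mathcal{O}_K^+$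 be such that there is a $P\in S$ with $N(P)=\rho_7\cdot\theta$, and such that $Q$ represents $\theta$. Then $Q$ represents $\lambda\theta$ for every $\lambda\in\mathcal{O}_K^+$. -/

import Mathlib

open scoped Quaternion NumberField

namespace QuatForm

noncomputable section

/-- The real number `ζ + ζ⁻¹`, for a complex primitive seventh root of unity `ζ`
(it equals `ζ + ζ⁻¹` as a complex number by `traceReal_coe`). -/
def traceReal (ζ : ℂ) : ℝ := (ζ + ζ⁻¹).re

theorem traceReal_coe {ζ : ℂ} (hζ : IsPrimitiveRoot ζ 7) :
    ((traceReal ζ : ℝ) : ℂ) = ζ + ζ⁻¹ := by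
  have h1 : ‖ζ‖ = 1 := hζ.norm'_eq_one (by norm_num)
  have h2 : ζ⁻¹ = (starRingEnd ℂ) ζ := Complex.inv_eq_conj h1
  rw [traceReal, h2, Complex.add_conj]
  simp

/-- The real subfield `ℚ(ζ + ζ⁻¹)` of `ℝ`. -/
abbrev realField (ζ : ℂ) : IntermediateField ℚ ℝ :=
  IntermediateField.adjoin ℚ {traceReal ζ}

theorem isIntegral_traceReal {ζ : ℂ} (hζ : IsPrimitiveRoot ζ 7) :
    IsIntegral ℤ (traceReal ζ) := by
  have h : IsIntegral ℤ ((algebraMap ℝ ℂ) (traceReal ζ)) := by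
    change IsIntegral ℤ ((traceReal ζ : ℝ) : ℂ)
    rw [traceReal_coe hζ]
    exact (hζ.isIntegral (by norm_num)).add (hζ.inv.isIntegral (by norm_num))
  exact (isIntegral_algebraMap_iff (algebraMap ℝ ℂ).injective).1 h

/-- `ζ + ζ⁻¹` as an element of the ring of integers of `ℚ(ζ + ζ⁻¹)`. -/
def phi {ζ : ℂ} (hζ : IsPrimitiveRoot ζ 7) : 𝓞 (realField ζ) :=
  ⟨⟨traceReal ζ, IntermediateField.mem_adjoin_simple_self ℚ (traceReal ζ)⟩,
    (isIntegral_algebraMap_iff (algebraMap (realField ζ) ℝ).injective).1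
      (isIntegral_traceReal hζ)⟩

/-- `ρ₇ = 2 - (ζ + ζ⁻¹)`. -/
def rho7 {ζ : ℂ} (hζ : IsPrimitiveRoot ζ 7) : 𝓞 (realField ζ) := 2 - phi hζ

/-- An algebraic integer of `K` is totally positive if it is positive under every real
embedding of `K`. -/
def IsTotallyPositive {K : Type*} [Field K] (a : 𝓞 K) : Prop :=
  ∀ σ : K →+* ℝ, 0 < σ (a : K)

/-- The form `x² + xy + y² + z² + zw + w²` represents `a` over the ring `R`. -/
def Represents {R : Type*} [CommRing R] (a : R) : Prop :=
  ∃ x y z w : R, x ^ 2 + x * y + y ^ 2 + z ^ 2 + z * w + w ^ 2 = a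

/-- `α = (1 + i √3) / 2` in Hamilton's quaternions. -/
def quatAlpha : ℍ[ℝ] := ⟨1 / 2, √3 / 2, 0, 0⟩

/-- `β = j` in Hamilton's quaternions. -/
def quatBeta : ℍ[ℝ] := ⟨0, 0, 1, 0⟩

/-- The quaternion `x + y α + z β + w αβ`. -/
def quatOf (x y z w : ℝ) : ℍ[ℝ] :=
  (x : ℍ[ℝ]) + (y : ℍ[ℝ]) * quatAlpha + (z : ℍ[ℝ]) * quatBeta
    + (w : ℍ[ℝ]) * (quatAlpha * quatBeta)

theorem quatOf_re (x y z w : ℝ) : (quatOf x y z w).re = x + y / 2 := by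
  simp [quatOf, show quatAlpha.re = 1 / 2 from rfl, show quatAlpha.imI = √3 / 2 from rfl,
    show quatAlpha.imJ = 0 from rfl, show quatAlpha.imK = 0 from rfl,
    show quatBeta.re = 0 from rfl, show quatBeta.imI = 0 from rfl,
    show quatBeta.imJ = 1 from rfl, show quatBeta.imK = 0 from rfl]
  ring

theorem quatOf_imI (x y z w : ℝ) : (quatOf x y z w).imI = y * (√3 / 2) := by
  simp [quatOf, show quatAlpha.re = 1 / 2 from rfl, show quatAlpha.imI = √3 / 2 from rfl,
    show quatAlpha.imJ = 0 from rfl, show quatAlpha.imK = 0 from rfl,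
    show quatBeta.re = 0 from rfl, show quatBeta.imI = 0 from rfl,
    show quatBeta.imJ = 1 from rfl, show quatBeta.imK = 0 from rfl]

theorem quatOf_imJ (x y z w : ℝ) : (quatOf x y z w).imJ = z + w / 2 := by
  simp [quatOf, show quatAlpha.re = 1 / 2 from rfl, show quatAlpha.imI = √3 / 2 from rfl,
    show quatAlpha.imJ = 0 from rfl, show quatAlpha.imK = 0 from rfl,
    show quatBeta.re = 0 from rfl, show quatBeta.imI = 0 from rfl,
    show quatBeta.imJ = 1 from rfl, show quatBeta.imK = 0 from rfl]
  ring

theorem quatOf_imK (x y z w : ℝ) : (quatOf x y z w).imK = w * (√3 / 2) := by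
  simp [quatOf, show quatAlpha.re = 1 / 2 from rfl, show quatAlpha.imI = √3 / 2 from rfl,
    show quatAlpha.imJ = 0 from rfl, show quatAlpha.imK = 0 from rfl,
    show quatBeta.re = 0 from rfl, show quatBeta.imI = 0 from rfl,
    show quatBeta.imJ = 1 from rfl, show quatBeta.imK = 0 from rfl]

theorem quatOf_add (x y z w x' y' z' w' : ℝ) :
    quatOf x y z w + quatOf x' y' z' w' = quatOf (x + x') (y + y') (z + z') (w + w') := by
  ext <;> simp [quatOf_re, quatOf_imI, quatOf_imJ, quatOf_imK] <;> ring

theorem quatOf_mul (x y z w x' y' z' w' : ℝ) :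
    quatOf x y z w * quatOf x' y' z' w' =
      quatOf (x * x' - y * y' - z * z' - z * w' - w * w')
        (x * y' + y * x' + y * y' + z * w' - w * z')
        (x * z' - y * w' + z * x' + z * y' + w * y')
        (x * w' + y * z' + y * w' - z * y' + w * x') := by
  have h : √3 * √3 = (3 : ℝ) := Real.mul_self_sqrt (by norm_num)
  ext <;> simp [quatOf_re, quatOf_imI, quatOf_imJ, quatOf_imK] <;> grind

/-- The ring `H = {x + y α + z β + w αβ : x, y, z, w ∈ 𝓞 K}` of quaternions,
where `K = ℚ(ζ + ζ⁻¹)`. -/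
def quatRing (ζ : ℂ) : Subring ℍ[ℝ] where
  carrier := {L | ∃ x y z w : 𝓞 (realField ζ),
    L = quatOf (algebraMap _ ℝ x) (algebraMap _ ℝ y) (algebraMap _ ℝ z) (algebraMap _ ℝ w)}
  mul_mem' := by
    rintro _ _ ⟨x, y, z, w, rfl⟩ ⟨x', y', z', w', rfl⟩
    refine ⟨x * x' - y * y' - z * z' - z * w' - w * w',
      x * y' + y * x' + y * y' + z * w' - w * z',
      x * z' - y * w' + z * x' + z * y' + w * y',
      x * w' + y * z' + y * w' - z * y' + w * x', ?_⟩
    rw [quatOf_mul]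
    simp only [map_add, map_sub, map_mul]
  one_mem' := ⟨1, 0, 0, 0, by ext <;> simp [quatOf_re, quatOf_imI, quatOf_imJ, quatOf_imK]⟩
  add_mem' := by
    rintro _ _ ⟨x, y, z, w, rfl⟩ ⟨x', y', z', w', rfl⟩
    exact ⟨x + x', y + y', z + z', w + w', by rw [quatOf_add]; simp only [map_add]⟩
  zero_mem' := ⟨0, 0, 0, 0, by ext <;> simp [quatOf_re, quatOf_imI, quatOf_imJ, quatOf_imK]⟩
  neg_mem' := by
    rintro _ ⟨x, y, z, w, rfl⟩
    exact ⟨-x, -y, -z, -w, by ext <;> simp [quatOf_re, quatOf_imI, quatOf_imJ, quatOf_imK] <;> ring⟩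

/-- The element `x + y α + z β + w αβ` of `H`. -/
def elt {ζ : ℂ} (x y z w : 𝓞 (realField ζ)) : quatRing ζ :=
  ⟨quatOf (algebraMap _ ℝ x) (algebraMap _ ℝ y) (algebraMap _ ℝ z) (algebraMap _ ℝ w),
    x, y, z, w, rfl⟩

/-- The left ideal `S = H (1 + α + 2β) + H ρ₇` of `H`
(an `Ideal` of a noncommutative ring is a left ideal). -/
def idealS {ζ : ℂ} (hζ : IsPrimitiveRoot ζ 7) : Ideal (quatRing ζ) :=
  Ideal.span {elt 1 1 2 0} ⊔ Ideal.span {elt (rho7 hζ) 0 0 0}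

end

end QuatForm

/-! Put γ = 1 + α + 2β and call l of the genus if l is a norm from H, or if ρl is the norm of some p
with p γ̄ ∈ ρH; every element of S is such a p. The heart of the matter is `inGenus_of_pos`: every
totally positive l is of the genus. Multiplicativity then finishes. If λ = N(q) and θ = N(r), then
λθ = N(qr). If instead ρλ = N(p) and ρθ = N(p') with p, p' as above, then p p̄' = ρk and N(k) = λθ
(`exists_nrm_mul`). So θ is asked to be represented in both ways.

To place l in the genus, factors 3 and square factors are stripped, since 3 and squares are norms.
For l squarefree and prime to 3, the congruence u₁² + u₁u₂ + u₂² ≡ -1 mod l defines a lattice in ℝ¹²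
of quaternions whose norm is divisible by l. Minkowski's theorem gives a nonzero g in it with N(g) =
lm and Tr(m/ρ²) < 4 (`exists_short_multiple`). As ρ² generates the different, only finitely many
totally positive m occur; up to unit squares and Galois conjugation they are nine
(`exists_representative`).

Each representative m is then divided out of g (`Reduces`). Apart from 1 and the ramified case 3,
H/mH is a ring of 2 × 2 matrices in which g is singular. An explicit q of norm m or mρ, adjusted by
a unit e, satisfies g (qe)‾ ∈ mH, and the quotient has norm l or lρ. The remaining ρ is removed by
`reduces_rho`, the one place where the second form enters. -/

namespace QuatForm

/-! ### Computable arithmetic in ℤ[φ] -/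

/-- The cubic algebra `R[φ]` with `φ³ + φ² - 2φ - 1 = 0`; the element `a + b φ + c φ²`. -/
@[ext]
structure Cubic (R : Type*) where
  a : R
  b : R
  c : R
deriving DecidableEq

namespace Cubic

variable {R : Type*}

instance [Fintype R] : Fintype (Cubic R) :=
  Fintype.ofEquiv (R × R × R)
    { toFun := fun x => ⟨x.1, x.2.1, x.2.2⟩
      invFun := fun x => (x.a, x.b, x.c)
      left_inv := fun _ => rfl
      right_inv := fun _ => rfl }

variable [CommRing R]

instance : Zero (Cubic R) := ⟨⟨0, 0, 0⟩⟩
instance : One (Cubic R) := ⟨⟨1, 0, 0⟩⟩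
instance : Add (Cubic R) := ⟨fun x y => ⟨x.a + y.a, x.b + y.b, x.c + y.c⟩⟩
instance : Neg (Cubic R) := ⟨fun x => ⟨-x.a, -x.b, -x.c⟩⟩
instance : Sub (Cubic R) := ⟨fun x y => ⟨x.a - y.a, x.b - y.b, x.c - y.c⟩⟩
instance : Mul (Cubic R) := ⟨fun x y =>
  ⟨x.a * y.a + (x.b * y.c + x.c * y.b) - x.c * y.c,
    x.a * y.b + x.b * y.a + 2 * (x.b * y.c + x.c * y.b) - x.c * y.c,
    x.a * y.c + x.b * y.b + x.c * y.a - (x.b * y.c + x.c * y.b) + 3 * (x.c * y.c)⟩⟩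

@[simp] theorem zero_a : (0 : Cubic R).a = 0 := rfl
@[simp] theorem zero_b : (0 : Cubic R).b = 0 := rfl
@[simp] theorem zero_c : (0 : Cubic R).c = 0 := rfl
@[simp] theorem one_a : (1 : Cubic R).a = 1 := rfl
@[simp] theorem one_b : (1 : Cubic R).b = 0 := rfl
@[simp] theorem one_c : (1 : Cubic R).c = 0 := rfl
@[simp] theorem add_a (x y : Cubic R) : (x + y).a = x.a + y.a := rfl
@[simp] theorem add_b (x y : Cubic R) : (x + y).b = x.b + y.b := rfl
@[simp] theorem add_c (x y : Cubic R) : (x + y).c = x.c + y.c := rfl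
@[simp] theorem neg_a (x : Cubic R) : (-x).a = -x.a := rfl
@[simp] theorem neg_b (x : Cubic R) : (-x).b = -x.b := rfl
@[simp] theorem neg_c (x : Cubic R) : (-x).c = -x.c := rfl
@[simp] theorem sub_a (x y : Cubic R) : (x - y).a = x.a - y.a := rfl
@[simp] theorem sub_b (x y : Cubic R) : (x - y).b = x.b - y.b := rfl
@[simp] theorem sub_c (x y : Cubic R) : (x - y).c = x.c - y.c := rfl
@[simp] theorem mul_a (x y : Cubic R) : (x * y).a =
    x.a * y.a + (x.b * y.c + x.c * y.b) - x.c * y.c := rfl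
@[simp] theorem mul_b (x y : Cubic R) : (x * y).b =
    x.a * y.b + x.b * y.a + 2 * (x.b * y.c + x.c * y.b) - x.c * y.c := rfl
@[simp] theorem mul_c (x y : Cubic R) : (x * y).c =
    x.a * y.c + x.b * y.b + x.c * y.a - (x.b * y.c + x.c * y.b) + 3 * (x.c * y.c) := rfl

instance : CommRing (Cubic R) where
  add_assoc x y z := by ext <;> simp [add_assoc]
  zero_add x := by ext <;> simp
  add_zero x := by ext <;> simp
  add_comm x y := by ext <;> simp [add_comm]
  left_distrib x y z := by ext <;> simp <;> ring
  right_distrib x y z := by ext <;> simp <;> ring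
  zero_mul x := by ext <;> simp
  mul_zero x := by ext <;> simp
  mul_assoc x y z := by ext <;> simp <;> ring
  one_mul x := by ext <;> simp
  mul_one x := by ext <;> simp
  neg_add_cancel x := by ext <;> simp
  mul_comm x y := by ext <;> simp <;> ring
  sub_eq_add_neg x y := by ext <;> simp [sub_eq_add_neg]
  nsmul := nsmulRec
  zsmul := zsmulRec

/-- The ring homomorphism from `ℤ[φ]` sending `φ` to a given root of `X³ + X² - 2X - 1`. -/
def lift {S : Type*} [CommRing S] (t : S) (ht : t ^ 3 + t ^ 2 - 2 * t - 1 = 0) :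
    Cubic ℤ →+* S where
  toFun x := x.a + x.b * t + x.c * (t * t)
  map_one' := by simp
  map_zero' := by simp
  map_add' x y := by simp; ring
  map_mul' x y := by
    simp only [mul_a, mul_b, mul_c]
    push_cast
    linear_combination (-(x.b * y.c : S) - x.c * y.b - x.c * y.c * t + x.c * y.c) * ht

theorem lift_apply {S : Type*} [CommRing S] (t : S) (ht : t ^ 3 + t ^ 2 - 2 * t - 1 = 0)
    (x : Cubic ℤ) : lift t ht x = x.a + x.b * t + x.c * (t * t) := rfl

/-- The generator `φ`. -/
def gen : Cubic R := ⟨0, 1, 0⟩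

theorem gen_root : (gen : Cubic R) ^ 3 + gen ^ 2 - 2 * gen - 1 = 0 := by
  have h2 : (2 : Cubic R) = 1 + 1 := by norm_num
  rw [h2]
  (ext <;> simp [gen, pow_succ]); ring

theorem intCast_eq (n : ℤ) : (n : Cubic R) = ⟨n, 0, 0⟩ := by
  have h : ∀ m : ℕ, (m : Cubic R) = ⟨m, 0, 0⟩ := fun m => by
    induction m with
    | zero => ext <;> simp
    | succ k ih => rw [Nat.cast_succ, ih]; ext <;> simp
  obtain ⟨m, rfl | rfl⟩ := n.eq_nat_or_neg
  · rw [Int.cast_natCast, h]; simp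
  · rw [Int.cast_neg, Int.cast_natCast, h]; ext <;> simp

theorem eq_gen (x : Cubic ℤ) :
    x = (x.a : Cubic ℤ) + (x.b : Cubic ℤ) * gen + (x.c : Cubic ℤ) * (gen * gen) := by
  simp only [intCast_eq]
  ext <;> simp [gen]

/-- Reduction of `ℤ[φ]` modulo an integer. -/
def red (n : ℕ) : Cubic ℤ →+* Cubic (ZMod n) := lift gen gen_root

theorem red_apply (n : ℕ) (x : Cubic ℤ) : red n x = ⟨x.a, x.b, x.c⟩ := by
  simp only [red, lift_apply, intCast_eq]
  ext <;> simp [gen]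

theorem dvd_of_red_eq_zero (n : ℕ) (x : Cubic ℤ) (h : red n x = 0) : (⟨n, 0, 0⟩ : Cubic ℤ) ∣ x := by
  rw [red_apply, Cubic.ext_iff] at h
  obtain ⟨h1, h2, h3⟩ := h
  obtain ⟨a, ha⟩ := (ZMod.intCast_zmod_eq_zero_iff_dvd _ _).1 h1
  obtain ⟨b, hb⟩ := (ZMod.intCast_zmod_eq_zero_iff_dvd _ _).1 h2
  obtain ⟨c, hc⟩ := (ZMod.intCast_zmod_eq_zero_iff_dvd _ _).1 h3
  exact ⟨⟨a, b, c⟩, by ext <;> simp [ha, hb, hc]⟩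

/-- The automorphism `φ ↦ φ² - 2` of `ℤ[φ]`. -/
def conj : Cubic ℤ →+* Cubic ℤ := lift ⟨-2, 0, 1⟩ (by decide)

theorem conj_apply (x : Cubic ℤ) : conj x = ⟨x.a - 2 * x.b + 3 * x.c, -x.c, x.b - x.c⟩ := by
  simp only [conj, lift_apply, intCast_eq]
  ext <;> simp <;> ring

theorem conj_conj_conj (x : Cubic ℤ) : conj (conj (conj x)) = x := by
  simp only [conj_apply]
  ext <;> simp <;> ring

end Cubic

/-! ### The ring of integers of K is ℤ[φ] -/

open Polynomial in
theorem exists_modCyclotomic (p : ℤ[X]) : ∃ n : Fin 6 → ℤ, cyclotomic 7 ℤ ∣ p - ∑ i, C (n i) * X ^ (i : ℕ) := by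
  have hm : (cyclotomic 7 ℤ).Monic := cyclotomic.monic 7 ℤ
  have hd : (cyclotomic 7 ℤ).natDegree = 6 := by
    rw [natDegree_cyclotomic, Nat.totient_prime (by norm_num)]
  refine ⟨fun i => (p %ₘ cyclotomic 7 ℤ).coeff i, p /ₘ cyclotomic 7 ℤ, ?_⟩
  have h1 : (p %ₘ cyclotomic 7 ℤ).natDegree < 6 := by
    rw [← hd]
    exact natDegree_modByMonic_lt _ hm (fun h => by rw [h] at hd; simp at hd)
  have h2 := (p %ₘ cyclotomic 7 ℤ).as_sum_range_C_mul_X_pow' h1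
  rw [Fin.sum_univ_eq_sum_range (fun i => C ((p %ₘ cyclotomic 7 ℤ).coeff i) * X ^ i) 6, ← h2]
  rw [sub_eq_iff_eq_add, add_comm]
  exact (modByMonic_add_div p _).symm

section

variable {ζ : ℂ} (hζ : IsPrimitiveRoot ζ 7)
include hζ

theorem sum_pow_zeta : 1 + ζ + ζ ^ 2 + ζ ^ 3 + ζ ^ 4 + ζ ^ 5 + ζ ^ 6 = 0 := by
  have := hζ.geom_sum_eq_zero (by norm_num)
  simpa [Finset.sum_range_succ] using this

theorem traceReal_root :
    traceReal ζ ^ 3 + traceReal ζ ^ 2 - 2 * traceReal ζ - 1 = 0 := by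
  have h : ((traceReal ζ : ℝ) : ℂ) ^ 3 + (traceReal ζ : ℝ) ^ 2 - 2 * (traceReal ζ : ℝ) - 1 = 0 := by
    rw [traceReal_coe hζ]
    have h0 : ζ ≠ 0 := hζ.ne_zero (by norm_num)
    have := sum_pow_zeta hζ
    field_simp
    linear_combination this
  exact_mod_cast h

open Polynomial in
theorem zeta_indep (n : Fin 6 → ℤ) (h : ∑ i, (n i : ℂ) * ζ ^ (i : ℕ) = 0) : n = 0 := by
  set p : ℤ[X] := ∑ i, C (n i) * X ^ (i : ℕ) with hp
  have h1 : aeval ζ p = 0 := by simp [hp, map_sum, h]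
  have hdvd : cyclotomic 7 ℤ ∣ p := by
    rw [cyclotomic_eq_minpoly hζ (by norm_num)]
    exact minpoly.isIntegrallyClosed_dvd (hζ.isIntegral (by norm_num)) h1
  have hdeg : p.natDegree < 6 := by
    refine lt_of_le_of_lt (natDegree_sum_le_of_forall_le _ _ (n := 5) fun i _ => ?_) (by norm_num)
    exact (natDegree_C_mul_X_pow_le _ _).trans (by omega)
  have hp0 : p = 0 := by
    refine eq_zero_of_dvd_of_natDegree_lt hdvd ?_
    rwa [natDegree_cyclotomic, Nat.totient_prime (by norm_num)]
  funext i
  have := congrArg (fun q => q.coeff (i : ℕ)) hp0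
  simpa [hp, finsetSum_coeff, coeff_C_mul, coeff_X_pow, Fin.val_inj] using this

theorem ofReal_mem_adjoin (x : realField ζ) :
    ((x : ℝ) : ℂ) ∈ IntermediateField.adjoin ℚ ({ζ} : Set ℂ) := by
  have h : (realField ζ).map (Complex.ofRealAm.restrictScalars ℚ) ≤
      IntermediateField.adjoin ℚ ({ζ} : Set ℂ) := by
    rw [IntermediateField.adjoin_map, Set.image_singleton,
      IntermediateField.adjoin_simple_le_iff]
    change ((traceReal ζ : ℝ) : ℂ) ∈ _
    rw [traceReal_coe hζ]
    have := IntermediateField.mem_adjoin_simple_self ℚ ζ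
    exact add_mem this (inv_mem this)
  exact h ⟨x, x.2, rfl⟩

-- The element lies in ℚ(ζ) and is integral there, and the ring of integers of ℚ(ζ) is ℤ[ζ].
open Polynomial in
theorem exists_eq_sum_zeta (x : 𝓞 (realField ζ)) :
    ∃ n : Fin 6 → ℤ, (((x : realField ζ) : ℝ) : ℂ) = ∑ i, (n i : ℂ) * ζ ^ (i : ℕ) := by
  let L := IntermediateField.adjoin ℚ ({ζ} : Set ℂ)
  have : Fact (Nat.Prime 7) := ⟨by norm_num⟩
  have : NeZero (7 : ℕ) := ⟨by norm_num⟩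
  have : IsCyclotomicExtension {7} ℚ L := by
    change IsCyclotomicExtension {7} ℚ L.toSubalgebra
    rw [IntermediateField.adjoin_simple_toSubalgebra_of_isAlgebraic
      ((hζ.isIntegral (by norm_num)).tower_top (A := ℚ)).isAlgebraic]
    exact hζ.adjoin_isCyclotomicExtension ℚ
  let ζL : L := ⟨ζ, IntermediateField.mem_adjoin_simple_self ℚ ζ⟩
  have hζL : IsPrimitiveRoot ζL 7 :=
    IsPrimitiveRoot.of_map_of_injective (f := algebraMap L ℂ) hζ (algebraMap L ℂ).injective
  have := IsCyclotomicExtension.Rat.isIntegralClosure_adjoin_singleton_of_prime hζL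
  let y : L := ⟨(((x : realField ζ) : ℝ) : ℂ), ofReal_mem_adjoin hζ _⟩
  have hy : IsIntegral ℤ y := by
    refine (isIntegral_algebraMap_iff (algebraMap L ℂ).injective).1 ?_
    change IsIntegral ℤ (algebraMap ℝ ℂ (algebraMap (realField ζ) ℝ x))
    exact (x.2.map (IsScalarTower.toAlgHom ℤ (realField ζ) ℝ)).map
      (IsScalarTower.toAlgHom ℤ ℝ ℂ)
  obtain ⟨z, hz⟩ := (IsIntegralClosure.isIntegral_iff (A := Algebra.adjoin ℤ ({ζL} : Set L))).1 hy
  obtain ⟨p, hp⟩ := (Algebra.adjoin_singleton_eq_range_aeval ℤ ζL).le z.2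
  have hpy : aeval ζ p = (((x : realField ζ) : ℝ) : ℂ) := by
    have h1 : aeval ζL p = y := hp.trans hz
    have h2 := congrArg (algebraMap L ℂ) h1
    rwa [← aeval_algebraMap_apply] at h2
  obtain ⟨n, q, hq⟩ := exists_modCyclotomic p
  refine ⟨n, ?_⟩
  have h3 := congrArg (aeval ζ) hq
  have h4 : aeval ζ (cyclotomic 7 ℤ) = 0 := by
    rw [cyclotomic_eq_minpoly hζ (by norm_num)]
    exact minpoly.aeval _ _
  rw [map_sub, map_mul, h4, zero_mul, hpy, sub_eq_zero] at h3
  rw [h3]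
  simp [map_sum]

/-- An element of ℤ[ζ] that is real equals its complex conjugate. Comparing coordinates in 1, ζ, …,
ζ⁵ makes it a combination of 1, ζ² + ζ⁻² and ζ³ + ζ⁻³. -/
theorem exists_eq_cubic (x : 𝓞 (realField ζ)) :
    ∃ y : Cubic ℤ, ((x : realField ζ) : ℝ) = y.a + y.b * traceReal ζ +
      y.c * (traceReal ζ * traceReal ζ) := by
  obtain ⟨n, hn⟩ := exists_eq_sum_zeta hζ x
  have h0 : ζ ≠ 0 := hζ.ne_zero (by norm_num)
  have hs := sum_pow_zeta hζ
  have h7 : ζ ^ 7 = 1 := hζ.pow_eq_one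
  have hinv : ζ⁻¹ = ζ ^ 6 := by
    field_simp
    exact h7.symm
  have hconj : (starRingEnd ℂ) ζ = ζ ^ 6 := by
    rw [← hinv, Complex.inv_eq_conj (hζ.norm'_eq_one (by norm_num))]
  have hc := congrArg (starRingEnd ℂ) hn
  rw [Complex.conj_ofReal, hn] at hc
  simp only [map_sum, map_mul, map_pow, hconj, map_intCast] at hc
  -- The vector holds the coordinates of x - x̄, after ζ⁶ is replaced by -(1 + ζ + ⋯ + ζ⁵).
  have key := zeta_indep hζ ![n 1, 2 * n 1, n 1 + n 2 - n 5, n 1 + n 3 - n 4,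
    n 1 + n 4 - n 3, n 1 + n 5 - n 2] (by
      simp only [Fin.sum_univ_six] at hc ⊢
      simp at hc ⊢
      linear_combination hc + n 1 * hs + (n 2 * ζ ^ 5 + n 3 * (ζ ^ 4 + ζ ^ 11) + n 4 * (ζ ^ 3 + ζ ^ 10 + ζ ^ 17) + n 5 * (ζ ^ 2 + ζ ^ 9 + ζ ^ 16 + ζ ^ 23)) * h7)
  have k0 : n 1 = 0 := by simpa using congrFun key 0
  have k2 : n 1 + n 2 - n 5 = 0 := by simpa using congrFun key 2
  have k3 : n 1 + n 3 - n 4 = 0 := by simpa using congrFun key 3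
  have e5 : n 5 = n 2 := by omega
  have e4 : n 4 = n 3 := by omega
  -- Here ζ² + ζ⁻² = φ² - 2 and ζ³ + ζ⁻³ = 1 - φ - φ².
  refine ⟨⟨n 0 - 2 * n 2 + n 3, -n 3, n 2 - n 3⟩, ?_⟩
  have : (((x : realField ζ) : ℝ) : ℂ) = (n 0 - 2 * n 2 + n 3 : ℂ) + (-n 3 : ℂ) * (traceReal ζ : ℝ)
      + (n 2 - n 3 : ℂ) * ((traceReal ζ : ℝ) * (traceReal ζ : ℝ)) := by
    rw [hn, traceReal_coe hζ, hinv]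
    simp only [Fin.sum_univ_six]
    simp [k0, e5, e4]
    linear_combination (n 3 : ℂ) * hs - (n 2 - n 3 : ℂ) * (2 + ζ ^ 5) * h7
  have h' : ((x : realField ζ) : ℝ) = (n 0 - 2 * n 2 + n 3 : ℝ) + (-n 3 : ℝ) * traceReal ζ
      + (n 2 - n 3 : ℝ) * (traceReal ζ * traceReal ζ) := by exact_mod_cast this
  rw [h']
  push_cast
  rfl

end

section

variable {ζ : ℂ} (hζ : IsPrimitiveRoot ζ 7)

include hζ in
theorem phi_root : phi hζ ^ 3 + phi hζ ^ 2 - 2 * phi hζ - 1 = 0 := by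
  apply NumberField.RingOfIntegers.ext
  apply Subtype.ext
  exact traceReal_root hζ

theorem algebraMap_lift_phi (x : Cubic ℤ) :
    algebraMap (𝓞 (realField ζ)) ℝ (Cubic.lift (phi hζ) (phi_root hζ) x)
      = Cubic.lift (traceReal ζ) (traceReal_root hζ) x := by
  simp only [Cubic.lift_apply, map_add, map_mul, map_intCast]
  rfl

theorem lift_traceReal_injective :
    Function.Injective (Cubic.lift (traceReal ζ) (traceReal_root hζ)) := by
  rw [injective_iff_map_eq_zero]
  intro x hx
  have h0 : ζ ≠ 0 := hζ.ne_zero (by norm_num)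
  have h1 : (x.a : ℂ) + x.b * (traceReal ζ : ℝ) + x.c * ((traceReal ζ : ℝ) * (traceReal ζ : ℝ)) = 0 := by
    rw [Cubic.lift_apply] at hx
    exact_mod_cast hx
  rw [traceReal_coe hζ] at h1
  -- The coefficients are those of ζ² times the relation, which clears the negative powers of ζ.
  have key := zeta_indep hζ ![x.c, x.b, x.a + 2 * x.c, x.b, x.c, 0] (by
    simp only [Fin.sum_univ_six]
    simp
    field_simp at h1
    linear_combination h1)
  have k0 : x.c = 0 := by simpa using congrFun key 0
  have k1 : x.b = 0 := by simpa using congrFun key 1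
  have k2 : x.a + 2 * x.c = 0 := by simpa using congrFun key 2
  ext
  · simpa [k0] using k2
  · simpa using k1
  · simpa using k0

/-- The ring of integers of `ℚ(ζ + ζ⁻¹)` is `ℤ[ζ + ζ⁻¹]`. -/
noncomputable def cubicEquiv : Cubic ℤ ≃+* 𝓞 (realField ζ) :=
  RingEquiv.ofBijective (Cubic.lift (phi hζ) (phi_root hζ)) (by
    constructor
    · intro x y h
      refine lift_traceReal_injective hζ ?_
      rw [← algebraMap_lift_phi hζ, h, algebraMap_lift_phi hζ]
    · intro x
      obtain ⟨y, hy⟩ := exists_eq_cubic hζ x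
      refine ⟨y, ?_⟩
      apply NumberField.RingOfIntegers.ext
      apply Subtype.ext
      rw [hy]
      exact algebraMap_lift_phi hζ y)

theorem cubicEquiv_apply (x : Cubic ℤ) :
    cubicEquiv hζ x = Cubic.lift (phi hζ) (phi_root hζ) x := rfl

theorem algebraMap_cubicEquiv (x : Cubic ℤ) :
    algebraMap (𝓞 (realField ζ)) ℝ (cubicEquiv hζ x)
      = Cubic.lift (traceReal ζ) (traceReal_root hζ) x :=
  algebraMap_lift_phi hζ x

theorem cubicEquiv_rho : cubicEquiv hζ ⟨2, -1, 0⟩ = rho7 hζ := by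
  simp [cubicEquiv_apply, Cubic.lift_apply, rho7, sub_eq_add_neg]

end

/-! ### Discriminant 49 and class number one -/

namespace Cubic

instance : IsDomain (Cubic ℤ) :=
  (cubicEquiv (Complex.isPrimitiveRoot_exp 7 (by norm_num))).toMulEquiv.isDomain _

theorem conj_injective : Function.Injective conj := fun x y h => by
  rw [← conj_conj_conj x, h, conj_conj_conj]

/-- The integral basis `1, φ, φ²`. -/
noncomputable def basis : Module.Basis (Fin 3) ℤ (Cubic ℤ) :=
  .ofEquivFun (AddEquiv.toIntLinearEquiv
    { toFun := fun x => ![x.a, x.b, x.c]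
      invFun := fun v => ⟨v 0, v 1, v 2⟩
      left_inv := fun _ => rfl
      right_inv := fun v => by ext i; fin_cases i <;> rfl
      map_add' := fun x y => by ext i; fin_cases i <;> rfl })

theorem basis_repr (x : Cubic ℤ) (i : Fin 3) : basis.repr x i = ![x.a, x.b, x.c] i := rfl

theorem basis_apply (i : Fin 3) : basis i = ![⟨1, 0, 0⟩, ⟨0, 1, 0⟩, ⟨0, 0, 1⟩] i := by
  apply basis.repr.injective
  rw [Module.Basis.repr_self]
  ext j
  rw [basis_repr]
  fin_cases i <;> fin_cases j <;> simp

instance : Module.Free ℤ (Cubic ℤ) := .of_basis basis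
instance : Module.Finite ℤ (Cubic ℤ) := .of_basis basis

theorem trace_eq (x : Cubic ℤ) : Algebra.trace ℤ (Cubic ℤ) x = 3 * x.a - x.b + 5 * x.c := by
  rw [Algebra.trace_eq_matrix_trace basis, Matrix.trace_fin_three]
  simp only [Algebra.leftMulMatrix_eq_repr_mul, basis_repr, basis_apply]
  simp
  ring

theorem discr_basis : Algebra.discr ℤ basis = 49 := by
  rw [Algebra.discr_def, Matrix.det_fin_three]
  simp only [Algebra.traceMatrix_apply, Algebra.traceForm_apply, trace_eq, basis_apply]
  simp

end Cubic

theorem numberField_realField {ζ : ℂ} (hζ : IsPrimitiveRoot ζ 7) : NumberField (realField ζ) where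
  to_charZero := inferInstance
  to_finiteDimensional := IntermediateField.adjoin.finiteDimensional
    ((isIntegral_traceReal hζ).tower_top)

/-- Minkowski's bound suffices: the discriminant is 49, and even allowing one complex place (the
crude consequence of r₁ + 2r₂ = 3) the comparison is 7 < 9π/4. -/
theorem isPrincipalIdealRing_integers {ζ : ℂ} (hζ : IsPrimitiveRoot ζ 7) :
    IsPrincipalIdealRing (𝓞 (realField ζ)) := by
  have := numberField_realField hζ
  let b : Module.Basis (Fin 3) ℤ (𝓞 (realField ζ)) :=
    Cubic.basis.map (cubicEquiv hζ).toAddEquiv.toIntLinearEquiv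
  have hd : NumberField.discr (realField ζ) = 49 := by
    rw [← NumberField.discr_eq_discr _ b, ← Cubic.discr_basis]
    exact (Algebra.discr_eq_discr_of_algEquiv _
      ((cubicEquiv hζ).toIntAlgEquiv)).symm
  have hf : Module.finrank ℚ (realField ζ) = 3 := by
    rw [← NumberField.RingOfIntegers.rank, Module.finrank_eq_card_basis b, Fintype.card_fin]
  have hr : NumberField.InfinitePlace.nrComplexPlaces (realField ζ) ≤ 1 := by
    have := NumberField.InfinitePlace.card_add_two_mul_card_eq_rank (realField ζ)
    omega
  apply RingOfIntegers.isPrincipalIdealRing_of_abs_discr_lt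
  rw [hd, hf]
  have hpi := Real.pi_gt_d4
  have hpi4 := Real.pi_le_four
  have h4 : Real.pi / 4 ≤ (Real.pi / 4) ^ NumberField.InfinitePlace.nrComplexPlaces (realField ζ) := by
    calc Real.pi / 4 = (Real.pi / 4) ^ 1 := (pow_one _).symm
      _ ≤ _ := pow_le_pow_of_le_one (by positivity) (by linarith) hr
  have h5 : (7 : ℝ) < 2 * ((Real.pi / 4) ^ NumberField.InfinitePlace.nrComplexPlaces (realField ζ) *
      ((3 : ℕ) ^ 3 / (Nat.factorial 3))) := by
    norm_num [Nat.factorial]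
    linarith
  calc ((|(49 : ℤ)| : ℤ) : ℝ) = 7 ^ 2 := by norm_num
    _ < _ := by
      rw [← mul_assoc] at h5
      gcongr

instance : IsPrincipalIdealRing (Cubic ℤ) := by
  have hζ := Complex.isPrimitiveRoot_exp 7 (by norm_num)
  have := isPrincipalIdealRing_integers hζ
  exact IsPrincipalIdealRing.of_surjective (cubicEquiv hζ).symm.toRingHom
    (cubicEquiv hζ).symm.surjective

/-! ### The real embeddings of ℤ[φ] -/

section

variable (t : ℝ) (ht : t ^ 3 + t ^ 2 - 2 * t - 1 = 0)

/-- The three real embeddings of `ℤ[φ]`, given a first root `t`. -/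
noncomputable def embed (i : Fin 3) : Cubic ℤ →+* ℝ :=
  Cubic.lift (![t, t ^ 2 - 2, -t ^ 2 - t + 1] i) (by
    fin_cases i
    · exact ht
    · simp
      linear_combination (t ^ 3 - t ^ 2 - 2 * t + 1) * ht
    · simp
      linear_combination (-t ^ 3 - 2 * t ^ 2 + t + 1) * ht)

theorem embed_zero_conj (x : Cubic ℤ) :
    embed t ht 0 (Cubic.conj x) = embed t ht 1 x ∧ embed t ht 0 (Cubic.conj (Cubic.conj x)) = embed t ht 2 x := by
  simp only [embed, Cubic.lift_apply, Cubic.conj_apply]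
  simp
  constructor
  · linear_combination (-x.c * t + x.c) * ht
  · linear_combination (-x.c * t - x.c) * ht

theorem embed_injective_of {i : Fin 3} (h0 : Function.Injective (embed t ht 0)) :
    Function.Injective (embed t ht i) := by
  fin_cases i
  · exact h0
  · intro x y h
    simp only [Fin.mk_one, ← (embed_zero_conj _ _ _).1] at h
    exact Cubic.conj_injective (h0 h)
  · intro x y h
    simp only [Fin.reduceFinMk, ← (embed_zero_conj _ _ _).2] at h
    exact Cubic.conj_injective (Cubic.conj_injective (h0 h))

end

/-- Each embedding of ℤ[φ] extends to the fraction field K, where total positivity applies. -/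
theorem embed_pos {ζ : ℂ} (hζ : IsPrimitiveRoot ζ 7) (x : Cubic ℤ)
    (hx : IsTotallyPositive (cubicEquiv hζ x)) (i : Fin 3) :
    0 < embed (traceReal ζ) (traceReal_root hζ) i x := by
  have := numberField_realField hζ
  have h0 : Function.Injective (embed (traceReal ζ) (traceReal_root hζ) 0) :=
    lift_traceReal_injective hζ
  have hinj := embed_injective_of _ _ (i := i) h0
  have hinj2 : Function.Injective
      ((embed (traceReal ζ) (traceReal_root hζ) i).comp (cubicEquiv hζ).symm.toRingHom) :=
    hinj.comp (cubicEquiv hζ).symm.injective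
  have h := hx (IsFractionRing.lift hinj2)
  rw [show ((cubicEquiv hζ x : 𝓞 (realField ζ)) : realField ζ) =
    algebraMap (𝓞 (realField ζ)) (realField ζ) (cubicEquiv hζ x) from rfl,
    IsFractionRing.lift_algebraMap] at h
  simpa using h

/-! ### The quaternion order and the two forms of the genus -/

/-- The quaternion order with basis `1, α, β, αβ` over `ℤ[φ]`. -/
abbrev QuatOrder : Type := ℍ[Cubic ℤ, -1, 1, -1]

namespace QuatOrder

/-- The norm form. -/
def nrm (q : QuatOrder) : Cubic ℤ :=
  q.re ^ 2 + q.re * q.imI + q.imI ^ 2 + q.imJ ^ 2 + q.imJ * q.imK + q.imK ^ 2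

theorem nrm_mul (p q : QuatOrder) : nrm (p * q) = nrm p * nrm q := by
  simp only [nrm, QuaternionAlgebra.re_mul, QuaternionAlgebra.imI_mul, QuaternionAlgebra.imJ_mul,
    QuaternionAlgebra.imK_mul]
  ring

theorem nrm_star (q : QuatOrder) : nrm (star q) = nrm q := by
  simp only [nrm, QuaternionAlgebra.re_star, QuaternionAlgebra.imI_star,
    QuaternionAlgebra.imJ_star, QuaternionAlgebra.imK_star]
  ring

theorem nrm_smul (r : Cubic ℤ) (q : QuatOrder) : nrm (r • q) = r ^ 2 * nrm q := by
  simp only [nrm, QuaternionAlgebra.re_smul, QuaternionAlgebra.imI_smul,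
    QuaternionAlgebra.imJ_smul, QuaternionAlgebra.imK_smul, smul_eq_mul]
  ring

theorem star_smul_eq (r : Cubic ℤ) (q : QuatOrder) : star (r • q) = r • star q := by
  ext1 <;> simp [mul_add]

/-- The coordinatewise automorphism of the order induced by `Cubic.conj`. -/
def conj (q : QuatOrder) : QuatOrder :=
  ⟨Cubic.conj q.re, Cubic.conj q.imI, Cubic.conj q.imJ, Cubic.conj q.imK⟩

theorem nrm_conj (q : QuatOrder) : nrm (conj q) = Cubic.conj (nrm q) := by
  simp only [nrm, conj, map_add, map_mul, map_pow]

theorem conj_mul (p q : QuatOrder) : conj (p * q) = conj p * conj q := by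
  ext1 <;> simp [conj]

theorem conj_star (q : QuatOrder) : conj (star q) = star (conj q) := by
  ext1 <;> simp [conj]

theorem conj_smul (r : Cubic ℤ) (q : QuatOrder) : conj (r • q) = Cubic.conj r • conj q := by
  ext1 <;> simp [conj]

end QuatOrder

open QuatOrder

/-- The element `ρ = 2 - φ` of `ℤ[φ]`. -/
def rho : Cubic ℤ := ⟨2, -1, 0⟩

/-- The quaternion `1 + α + 2 β`. -/
def gamma : QuatOrder := ⟨⟨1, 0, 0⟩, ⟨1, 0, 0⟩, ⟨2, 0, 0⟩, ⟨0, 0, 0⟩⟩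

/-- Being a norm from the left ideal `{p | p * star γ ∈ ρ H}`, up to the norm `ρ` of the ideal. -/
def IsIdealNorm (l : Cubic ℤ) : Prop :=
  ∃ p h : QuatOrder, p * star gamma = rho • h ∧ nrm p = rho * l

/-- Being represented by one of the two forms of the genus. -/
def InGenus (l : Cubic ℤ) : Prop := (∃ q : QuatOrder, nrm q = l) ∨ IsIdealNorm l

/-- Whenever `l * m` is a norm, `l` is represented by one of the two forms of the genus. -/
def Reduces (m : Cubic ℤ) : Prop := ∀ (g : QuatOrder) (l : Cubic ℤ), nrm g = l * m → InGenus l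

/-- The product p p̄' lies in ρH, and its norm is ρ²lm, so dividing by ρ gives the required
quaternion. -/
theorem exists_nrm_mul {l m : Cubic ℤ} (hl : IsIdealNorm l) (hm : IsIdealNorm m) :
    ∃ q : QuatOrder, nrm q = l * m := by
  obtain ⟨p, h, hp, hpn⟩ := hl
  obtain ⟨p', h', hp', hpn'⟩ := hm
  have e1 : gamma * star p' = rho • star h' := by
    rw [← star_smul_eq, ← hp', star_mul, star_star]
  -- The trace of γ is 3, prime to ρ: this is 5 · 3 - 14 = 1, with 14 = ρ · (8 + 6φ + 2φ²). Inserted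
  -- between p and p̄', it makes each term visibly divisible by ρ.
  have hg : (5 : QuatOrder) * gamma + star gamma * 5 + (rho * ⟨-8, -6, -2⟩ : Cubic ℤ) • 1 = 1 := by
    ext1 <;> rfl
  obtain ⟨k, hk⟩ : ∃ k : QuatOrder, p * star p' = rho • k := by
    refine ⟨p * 5 * star h' + h * 5 * star p' + (⟨-8, -6, -2⟩ : Cubic ℤ) • (p * star p'), ?_⟩
    calc p * star p' = p * ((5 : QuatOrder) * gamma + star gamma * 5 +
          (rho * ⟨-8, -6, -2⟩ : Cubic ℤ) • 1) * star p' := by rw [hg, mul_one]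
      _ = p * 5 * (gamma * star p') + (p * star gamma) * 5 * star p' +
          (rho * ⟨-8, -6, -2⟩ : Cubic ℤ) • (p * star p') := by
        simp only [mul_add, add_mul, mul_assoc, mul_smul_comm, smul_mul_assoc, one_mul]
      _ = _ := by
        rw [e1, hp]
        simp only [mul_smul_comm, smul_mul_assoc, smul_add, mul_smul]
  refine ⟨k, ?_⟩
  have h1 := congrArg nrm hk
  rw [nrm_mul, nrm_star, hpn, hpn', nrm_smul] at h1
  have hr : rho ^ 2 ≠ 0 := by decide
  apply mul_left_cancel₀ hr
  rw [← h1]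
  ring

theorem InGenus.mul_sq {l : Cubic ℤ} (k : Cubic ℤ) (h : InGenus l) : InGenus (k ^ 2 * l) := by
  rcases h with ⟨q, hq⟩ | ⟨p, h, hp, hpn⟩
  · exact .inl ⟨k • q, by rw [nrm_smul, hq]⟩
  · exact .inr ⟨k • p, k • h, by rw [smul_mul_assoc, hp, smul_comm],
      by rw [nrm_smul, hpn]; ring⟩

theorem InGenus.nrm_mul {l : Cubic ℤ} (k : QuatOrder) (h : InGenus l) : InGenus (nrm k * l) := by
  rcases h with ⟨q, hq⟩ | ⟨p, h, hp, hpn⟩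
  · exact .inl ⟨k * q, by rw [QuatOrder.nrm_mul, hq]⟩
  · exact .inr ⟨k * p, k * h, by rw [mul_assoc, hp, mul_smul_comm],
      by rw [QuatOrder.nrm_mul, hpn]; ring⟩

/-- The quaternion γ has rational coordinates, so it is fixed, while ρ is multiplied by the square
of the unit 1 - φ - φ². Rescaling by the inverse unit 1 - φ² restores both conditions. -/
theorem InGenus.conj {l : Cubic ℤ} (h : InGenus l) : InGenus (Cubic.conj l) := by
  rcases h with ⟨q, hq⟩ | ⟨p, h, hp, hpn⟩
  · exact .inl ⟨q.conj, by rw [nrm_conj, hq]⟩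
  · have e1 : (⟨1, -1, -1⟩ : Cubic ℤ) * ⟨1, 0, -1⟩ = 1 := by decide
    have e2 : Cubic.conj rho = rho * ⟨1, -1, -1⟩ ^ 2 := by decide
    refine .inr ⟨(⟨1, 0, -1⟩ : Cubic ℤ) • p.conj, (⟨1, -1, -1⟩ : Cubic ℤ) • h.conj, ?_, ?_⟩
    · have h1 := congrArg QuatOrder.conj hp
      have h2 : QuatOrder.conj gamma = gamma := by ext1 <;> decide
      rw [QuatOrder.conj_mul, conj_star, conj_smul, h2, e2] at h1
      rw [smul_mul_assoc, h1, smul_smul, smul_smul]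
      congr 1
    · rw [nrm_smul, nrm_conj, hpn, map_mul, e2]
      linear_combination (rho * Cubic.conj l) * ((⟨1, -1, -1⟩ : Cubic ℤ) * ⟨1, 0, -1⟩ + 1) * e1

theorem Reduces.conj {m : Cubic ℤ} (h : Reduces m) : Reduces (Cubic.conj m) := by
  intro g l hg
  have h1 := h g.conj.conj (Cubic.conj (Cubic.conj l)) (by
    rw [nrm_conj, nrm_conj, hg, map_mul, map_mul, Cubic.conj_conj_conj])
  have h2 := h1.conj
  rwa [Cubic.conj_conj_conj] at h2

theorem Reduces.mul_unit_sq {m e e' : Cubic ℤ} (he : e * e' = 1) (h : Reduces m) :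
    Reduces (m * e ^ 2) := by
  intro g l hg
  refine h (e' • g) l ?_
  rw [nrm_smul, hg]
  linear_combination l * m * (e * e' + 1) * he

theorem reduces_one : Reduces 1 := fun g l hg => .inl ⟨g, by rw [hg, mul_one]⟩

/-! ### Splitting the order modulo m -/

section

variable {F : Type*} [CommRing F]

/-- The image of `x + y α + z β + w αβ` in the `2 × 2` matrices over a ring in which
`a² + a c + c² = -1`. -/
def splitMat (a c : F) (q : ℍ[F, -1, 1, -1]) : Matrix (Fin 2) (Fin 2) F :=
  !![q.re + q.imJ * a - q.imK * c, -q.imI + q.imJ * (a + c) + q.imK * a;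
    q.imI + q.imJ * c + q.imK * (a + c), q.re + q.imI - q.imJ * a + q.imK * c]

theorem splitMat_mul {a c : F} (hac : a ^ 2 + a * c + c ^ 2 = -1) (p q : ℍ[F, -1, 1, -1]) :
    splitMat a c (p * q) = splitMat a c p * splitMat a c q := by
  ext i j
  fin_cases i <;> fin_cases j <;>
  simp [splitMat, Matrix.mul_apply, Fin.sum_univ_two]
  · linear_combination -(p.imJ * q.imJ + p.imJ * q.imK + p.imK * q.imK) * hac
  · linear_combination (p.imK * q.imJ - p.imJ * q.imK) * hac
  · linear_combination (p.imJ * q.imK - p.imK * q.imJ) * hac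
  · linear_combination -(p.imJ * q.imJ + p.imK * q.imJ + p.imK * q.imK) * hac

theorem det_splitMat {a c : F} (hac : a ^ 2 + a * c + c ^ 2 = -1) (q : ℍ[F, -1, 1, -1]) :
    (splitMat a c q).det = q.re ^ 2 + q.re * q.imI + q.imI ^ 2 + q.imJ ^ 2 + q.imJ * q.imK
      + q.imK ^ 2 := by
  rw [Matrix.det_fin_two]
  simp [splitMat]
  linear_combination -(q.imJ ^ 2 + q.imJ * q.imK + q.imK ^ 2) * hac

/-- The splitting is injective once 3 is invertible: 3 is the only obstruction to solving for the
four coordinates. -/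
theorem eq_zero_of_splitMat_eq_zero {a c : F} (hac : a ^ 2 + a * c + c ^ 2 = -1)
    (h3 : IsUnit (3 : F)) (q : ℍ[F, -1, 1, -1]) (h : splitMat a c q = 0) : q = 0 := by
  have h00 : q.re + q.imJ * a - q.imK * c = 0 := congrFun (congrFun h 0) 0
  have h01 : -q.imI + q.imJ * (a + c) + q.imK * a = 0 := congrFun (congrFun h 0) 1
  have h10 : q.imI + q.imJ * c + q.imK * (a + c) = 0 := congrFun (congrFun h 1) 0
  have h11 : q.re + q.imI - q.imJ * a + q.imK * c = 0 := congrFun (congrFun h 1) 1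
  have hy : q.imI = 0 := by
    apply h3.mul_left_cancel
    linear_combination h00 - 2 * h01 + 2 * h10 - h11
  have hzw : q.imJ * a - q.imK * c = 0 := by
    apply h3.mul_left_cancel
    linear_combination 2 * h00 - h01 + h10 - 2 * h11
  have hx : q.re = 0 := by linear_combination h00 - hzw
  have hzw2 : q.imJ * (a + c) + q.imK * a = 0 := by linear_combination h01 + hy
  have hz : q.imJ = 0 := by
    linear_combination -a * hzw - c * hzw2 + q.imJ * hac
  have hw : q.imK = 0 := by
    linear_combination (a + c) * hzw - a * hzw2 + q.imK * hac
  ext1 <;> assumption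

/-- Coordinatewise application of a ring homomorphism. -/
def mapOrder (π : Cubic ℤ →+* F) (q : QuatOrder) : ℍ[F, -1, 1, -1] :=
  ⟨π q.re, π q.imI, π q.imJ, π q.imK⟩

theorem mapOrder_mul (π : Cubic ℤ →+* F) (p q : QuatOrder) :
    mapOrder π (p * q) = mapOrder π p * mapOrder π q := by
  ext1 <;> simp [mapOrder]

theorem exists_eq_smul_of_mapOrder_eq_zero (π : Cubic ℤ →+* F) {m : Cubic ℤ}
    (hm : ∀ x, π x = 0 → m ∣ x) (q : QuatOrder) (h : mapOrder π q = 0) : ∃ k : QuatOrder, q = m • k := by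
  obtain ⟨x, hx⟩ := hm q.re (congrArg (·.re) h)
  obtain ⟨y, hy⟩ := hm q.imI (congrArg (·.imI) h)
  obtain ⟨z, hz⟩ := hm q.imJ (congrArg (·.imJ) h)
  obtain ⟨w, hw⟩ := hm q.imK (congrArg (·.imK) h)
  exact ⟨⟨x, y, z, w⟩, by ext1 <;> simpa⟩

/-- The columns of the matrix of `star q` are multiples of `(u, v)`, as expressed by minors. -/
def Kills (π : Cubic ℤ →+* F) (a c u v : F) (q : QuatOrder) : Prop :=
  ∀ j, u * splitMat a c (mapOrder π (star q)) 1 j = v * splitMat a c (mapOrder π (star q)) 0 j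

instance [DecidableEq F] (π : Cubic ℤ →+* F) (a c u v : F) (q : QuatOrder) :
    Decidable (Kills π a c u v q) := by unfold Kills; infer_instance

theorem mul_eq_zero_of_minors {M Q : Matrix (Fin 2) (Fin 2) F} {u v : F}
    (h : ∀ i, M i 0 * u + M i 1 * v = 0) (huv : u = 1 ∨ v = 1)
    (hQ : ∀ j, u * Q 1 j = v * Q 0 j) : M * Q = 0 := by
  ext i j
  rw [Matrix.mul_apply, Fin.sum_univ_two, Matrix.zero_apply]
  have h1 := h i
  have h2 := hQ j
  rcases huv with rfl | rfl
  · linear_combination M i 1 * h2 + Q 0 j * h1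
  · linear_combination -M i 0 * h2 + Q 1 j * h1

theorem exists_kernel {M : Matrix (Fin 2) (Fin 2) F} (hdet : M.det = 0)
    (hu : ∃ i j, IsUnit (M i j)) :
    ∃ s : F, (∀ i, M i 0 * s + M i 1 * 1 = 0) ∨ (∀ i, M i 0 * 1 + M i 1 * s = 0) := by
  rw [Matrix.det_fin_two] at hdet
  obtain ⟨i, j, hij⟩ := hu
  obtain ⟨r, hr⟩ := hij.exists_left_inv
  fin_cases i <;> fin_cases j <;> simp only [Fin.zero_eta, Fin.mk_one] at hr
  · refine ⟨-r * M 0 1, .inl fun i => ?_⟩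
    fin_cases i <;> simp only [Fin.zero_eta, Fin.mk_one]
    · linear_combination -M 0 1 * hr
    · linear_combination r * hdet - M 1 1 * hr
  · refine ⟨-r * M 0 0, .inr fun i => ?_⟩
    fin_cases i <;> simp only [Fin.zero_eta, Fin.mk_one]
    · linear_combination -M 0 0 * hr
    · linear_combination -r * hdet - M 1 0 * hr
  · refine ⟨-r * M 1 1, .inl fun i => ?_⟩
    fin_cases i <;> simp only [Fin.zero_eta, Fin.mk_one]
    · linear_combination -r * hdet - M 0 1 * hr
    · linear_combination -M 1 1 * hr
  · refine ⟨-r * M 1 0, .inr fun i => ?_⟩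
    fin_cases i <;> simp only [Fin.zero_eta, Fin.mk_one]
    · linear_combination r * hdet - M 0 0 * hr
    · linear_combination -M 1 0 * hr

/-- Six units of norm one. -/
def normOneUnits : List QuatOrder :=
  -- These are 1, α, α², β, αβ, α²β: the group generated by α and β modulo ±1, which acts trivially
  -- on lines.
  [⟨1, 0, 0, 0⟩, ⟨0, 1, 0, 0⟩, ⟨-1, 1, 0, 0⟩, ⟨0, 0, 1, 0⟩, ⟨0, 0, 0, 1⟩, ⟨0, 0, -1, 1⟩]

/-- Every line of the plane over `F` is killed by an element `q * e` with `q` in the list and `e`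
a unit. -/
def Covers (π : Cubic ℤ →+* F) (a c : F) (W : List QuatOrder) : Prop :=
  ∀ s : F, (∃ q ∈ W, ∃ e ∈ normOneUnits, Kills π a c s 1 (q * e)) ∧
    ∃ q ∈ W, ∃ e ∈ normOneUnits, Kills π a c 1 s (q * e)

instance [DecidableEq F] [Fintype F] (π : Cubic ℤ →+* F) (a c : F) (W : List QuatOrder) :
    Decidable (Covers π a c W) := by unfold Covers; infer_instance

/-- The matrix of g has determinant 0 and a unit entry, so it kills a vector with a coordinate 1.
Some (qe)‾ from the list has all its columns along that vector, so the product vanishes modulo m. -/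
theorem Covers.exists_mul_star_eq {π : Cubic ℤ →+* F} {a c : F} {W : List QuatOrder}
    (hW : Covers π a c W) (hac : a ^ 2 + a * c + c ^ 2 = -1) (h3 : IsUnit (3 : F)) {m : Cubic ℤ}
    (hm : ∀ x, π x = 0 → m ∣ x) (hm0 : π m = 0) (g : QuatOrder) (hg : m ∣ nrm g)
    (hu : ∃ i j, IsUnit (splitMat a c (mapOrder π g) i j)) :
    ∃ q ∈ W, ∃ e ∈ normOneUnits, ∃ k : QuatOrder, g * star (q * e) = m • k := by
  have hdet : (splitMat a c (mapOrder π g)).det = 0 := by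
    rw [det_splitMat hac]
    obtain ⟨x, hx⟩ := hg
    have := congrArg π hx
    rw [map_mul, hm0, zero_mul] at this
    simpa [nrm, mapOrder] using this
  suffices h : ∃ u v : F, (∀ i, splitMat a c (mapOrder π g) i 0 * u +
      splitMat a c (mapOrder π g) i 1 * v = 0) ∧ (u = 1 ∨ v = 1) ∧
      ∃ q ∈ W, ∃ e ∈ normOneUnits, Kills π a c u v (q * e) by
    obtain ⟨u, v, h1, h2, q, hq, e, he, hk⟩ := h
    refine ⟨q, hq, e, he, exists_eq_smul_of_mapOrder_eq_zero π hm _ ?_⟩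
    apply eq_zero_of_splitMat_eq_zero hac h3
    rw [mapOrder_mul, splitMat_mul hac]
    exact mul_eq_zero_of_minors h1 h2 hk
  obtain ⟨s, hs | hs⟩ := exists_kernel hdet hu
  · exact ⟨s, 1, hs, .inr rfl, (hW s).1⟩
  · exact ⟨1, s, hs, .inl rfl, (hW s).2⟩

end

theorem nrm_of_mem_normOneUnits : ∀ e ∈ normOneUnits, nrm e = 1 := by decide

theorem nrm_of_mul_star_eq {g q e k : QuatOrder} {l m n : Cubic ℤ} (hm : m ≠ 0) (hg : nrm g = l * m)
    (hq : nrm q = m * n) (he : e ∈ normOneUnits) (h : g * star (q * e) = m • k) :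
    nrm k = l * n := by
  have h1 := congrArg nrm h
  rw [nrm_mul, nrm_star, nrm_mul, nrm_of_mem_normOneUnits e he, hg, hq, nrm_smul] at h1
  apply mul_left_cancel₀ (pow_ne_zero 2 hm)
  rw [← h1]
  ring

instance : Fact (Nat.Prime 7) := ⟨by norm_num⟩
instance : Fact (Nat.Prime 13) := ⟨by norm_num⟩
instance : Fact (Nat.Prime 29) := ⟨by norm_num⟩
instance : Fact (Nat.Prime 41) := ⟨by norm_num⟩
instance : Fact (Nat.Prime 43) := ⟨by norm_num⟩

theorem Cubic.dvd_of_lift_eq_zero (p : ℕ) (f : ℤ)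
    (hf : (f : ZMod p) ^ 3 + (f : ZMod p) ^ 2 - 2 * f - 1 = 0) {m : Cubic ℤ}
    (h1 : m ∣ ⟨-f, 1, 0⟩) (h2 : m ∣ ⟨p, 0, 0⟩) (x : Cubic ℤ)
    (hx : Cubic.lift (f : ZMod p) hf x = 0) : m ∣ x := by
  rw [Cubic.lift_apply] at hx
  obtain ⟨k, hk⟩ := (ZMod.intCast_zmod_eq_zero_iff_dvd (x.a + x.b * f + x.c * (f * f)) p).1
    (by push_cast; exact hx)
  have : x = ⟨-f, 1, 0⟩ * ⟨x.b + f * x.c, x.c, 0⟩ + ⟨p, 0, 0⟩ * ⟨k, 0, 0⟩ := by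
    ext <;> simp
    linear_combination hk
  rw [this]
  exact dvd_add (h1.mul_right _) (h2.mul_right _)

/-- The quotient (g (qe)‾)/m has norm l or lρ. The residue ring need not be a field, so the case
without a unit entry is left as a hypothesis; this serves m = ρ². -/
theorem reduces_of_covers_of_nonunit {F : Type*} [CommRing F] {π : Cubic ℤ →+* F} {a c : F}
    {W : List QuatOrder} {m : Cubic ℤ} (hW : Covers π a c W) (hac : a ^ 2 + a * c + c ^ 2 = -1)
    (h3 : IsUnit (3 : F)) (hm : ∀ x, π x = 0 → m ∣ x) (hm0 : π m = 0) (hmne : m ≠ 0)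
    (hn : ∀ q ∈ W, nrm q = m * 1 ∨ nrm q = m * rho) (hr : Reduces rho)
    (hF : ∀ (g : QuatOrder) (l : Cubic ℤ), nrm g = l * m →
      (∀ i j, ¬ IsUnit (splitMat a c (mapOrder π g) i j)) → InGenus l) : Reduces m := by
  intro g l hg
  by_cases hu : ∃ i j, IsUnit (splitMat a c (mapOrder π g) i j)
  · obtain ⟨q, hq, e, he, k, hk⟩ :=
      hW.exists_mul_star_eq hac h3 hm hm0 g ⟨l, by rw [hg, mul_comm]⟩ hu
    rcases hn q hq with h | h
    · exact .inl ⟨k, by rw [nrm_of_mul_star_eq hmne hg h he hk, mul_one]⟩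
    · exact hr k l (nrm_of_mul_star_eq hmne hg h he hk)
  · push Not at hu
    exact hF g l hg hu

/-- Over a field a matrix without unit entries is zero, so g = mk and l = N(k)m is of the genus
along with m. -/
theorem inGenus_of_nonunit {F : Type*} [CommRing F] {π : Cubic ℤ →+* F} {a c : F} {m : Cubic ℤ}
    (hac : a ^ 2 + a * c + c ^ 2 = -1)
    (h3 : IsUnit (3 : F)) (hm : ∀ x, π x = 0 → m ∣ x) (hmne : m ≠ 0)
    (hF : ∀ x : F, x = 0 ∨ IsUnit x) (hmN : InGenus m)
    {g : QuatOrder} {l : Cubic ℤ} (hg : nrm g = l * m)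
    (hu : ∀ i j, ¬ IsUnit (splitMat a c (mapOrder π g) i j)) : InGenus l := by
  have h0 : splitMat a c (mapOrder π g) = 0 := by
    ext i j
    exact (hF _).resolve_right (hu i j)
  obtain ⟨k, rfl⟩ := exists_eq_smul_of_mapOrder_eq_zero π hm g
    (eq_zero_of_splitMat_eq_zero hac h3 _ h0)
  have : l = nrm k * m := by
    rw [nrm_smul] at hg
    apply mul_right_cancel₀ hmne
    rw [← hg]
    ring
  rw [this]
  exact hmN.nrm_mul k

/-! ### The nine representatives -/

/-- Modulo ρ the residue field is 𝔽₇. Unit multiples of one element of norm ρ miss some lines; γ, of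
norm 7, handles these, and g ē is then the p exhibiting l as a norm from the ideal. -/
theorem reduces_rho : Reduces rho := by
  have hm := Cubic.dvd_of_lift_eq_zero 7 2 (by decide) (m := rho) ⟨-1, by decide⟩
    ⟨⟨4, 3, 1⟩, by decide⟩
  have hac : (1 : ZMod 7) ^ 2 + 1 * 3 + 3 ^ 2 = -1 := by decide
  have h3 : IsUnit (3 : ZMod 7) := isUnit_iff_ne_zero.2 (by decide)
  have hW : Covers (Cubic.lift ((2 : ℤ) : ZMod 7) (by decide)) 1 3
    [⟨⟨1, 0, -1⟩, ⟨1, 0, 0⟩, 0, 0⟩, gamma] := by decide +kernel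
  have hr : rho ≠ 0 := by decide
  have hq : nrm ⟨⟨1, 0, -1⟩, ⟨1, 0, 0⟩, 0, 0⟩ = rho * 1 := by decide
  intro g l hg
  by_cases hu : ∃ i j, IsUnit (splitMat 1 3 (mapOrder (Cubic.lift ((2 : ℤ) : ZMod 7) (by decide)) g) i j)
  · obtain ⟨q, hqW, e, he, k, hk⟩ :=
      hW.exists_mul_star_eq hac h3 hm (by decide) g ⟨l, by rw [hg, mul_comm]⟩ hu
    rw [List.mem_pair] at hqW
    rcases hqW with rfl | rfl
    · exact .inl ⟨k, by rw [nrm_of_mul_star_eq hr hg hq he hk, mul_one]⟩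
    · refine .inr ⟨g * star e, k, by rw [← hk, star_mul, mul_assoc], ?_⟩
      rw [nrm_mul, nrm_star, nrm_of_mem_normOneUnits e he, hg]
      ring
  · push Not at hu
    exact inGenus_of_nonunit hac h3 hm hr (fun x => or_iff_not_imp_left.2 isUnit_iff_ne_zero.2)
      (.inl ⟨_, hq.trans (mul_one _)⟩) hg hu

theorem reduces_of_covers {F : Type*} [CommRing F] {π : Cubic ℤ →+* F} {a c : F}
    {W : List QuatOrder} {m : Cubic ℤ} (hW : Covers π a c W) (hac : a ^ 2 + a * c + c ^ 2 = -1)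
    (h3 : IsUnit (3 : F)) (hm : ∀ x, π x = 0 → m ∣ x) (hm0 : π m = 0)
    (hF : ∀ x : F, x = 0 ∨ IsUnit x) (hmne : m ≠ 0)
    (hn : ∀ q ∈ W, nrm q = m * 1 ∨ nrm q = m * rho) (hmN : ∃ q ∈ W, nrm q = m) : Reduces m :=
  reduces_of_covers_of_nonunit hW hac h3 hm hm0 hmne hn reduces_rho fun _ _ hg hu =>
    inGenus_of_nonunit hac h3 hm hmne hF (let ⟨q, _, hq⟩ := hmN; .inl ⟨q, hq⟩) hg hu

/-- The element 3 - 2φ generates a prime above 13, with φ ≡ 8. The listed elements have norm m or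
mρ, and their unit multiples cover all lines over 𝔽₁₃. The primes above 29, 41 and 43 are treated
alike. -/
theorem reduces_thirteen : Reduces ⟨3, -2, 0⟩ := by
  have hm := Cubic.dvd_of_lift_eq_zero 13 8 (by decide) (m := ⟨3, -2, 0⟩) ⟨⟨-4, -5, -2⟩, by decide⟩
    ⟨⟨7, 10, 4⟩, by decide⟩
  refine reduces_of_covers (W := [⟨⟨1, 0, -1⟩, ⟨1, -1, 0⟩, ⟨0, 0, 0⟩, ⟨0, 0, 0⟩⟩,
    ⟨⟨1, 0, -1⟩, ⟨0, 0, 0⟩, ⟨2, 0, -1⟩, ⟨0, 0, 0⟩⟩,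
    ⟨⟨1, 0, -1⟩, ⟨0, 0, 0⟩, ⟨0, 0, 0⟩, ⟨2, 0, -1⟩⟩,
    ⟨⟨2, 0, -1⟩, ⟨0, 0, 0⟩, ⟨1, -1, 0⟩, ⟨1, -1, 0⟩⟩])
    (a := 0) (c := 5) (by decide +kernel) (by decide) (isUnit_iff_ne_zero.2 (by decide)) hm
    (by decide) (fun x => or_iff_not_imp_left.2 isUnit_iff_ne_zero.2) (by decide)
    (by decide) (by decide)

theorem reduces_twentyNine : Reduces ⟨2, -2, 1⟩ := by
  have hm := Cubic.dvd_of_lift_eq_zero 29 18 (by decide) (m := ⟨2, -2, 1⟩) ⟨⟨-8, -5, -1⟩, by decide⟩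
    ⟨⟨13, 9, 2⟩, by decide⟩
  refine reduces_of_covers (W := [⟨⟨1, -1, 0⟩, ⟨0, 0, 0⟩, ⟨-1, 0, 0⟩, ⟨0, 0, 0⟩⟩,
    ⟨⟨1, -1, 0⟩, ⟨0, 0, 0⟩, ⟨0, 0, 0⟩, ⟨-1, 0, 0⟩⟩,
    ⟨⟨1, 0, -1⟩, ⟨0, 0, 0⟩, ⟨1, 0, -1⟩, ⟨1, 0, 0⟩⟩,
    ⟨⟨1, 0, -1⟩, ⟨0, 0, 0⟩, ⟨1, 0, 0⟩, ⟨1, 0, -1⟩⟩,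
    ⟨⟨3, 0, -2⟩, ⟨0, 0, 0⟩, ⟨0, 1, -1⟩, ⟨1, 0, 0⟩⟩,
    ⟨⟨3, 0, -2⟩, ⟨0, 0, 0⟩, ⟨1, 0, 0⟩, ⟨0, 1, -1⟩⟩])
    (a := 0) (c := 12) (by decide +kernel) (by decide) (isUnit_iff_ne_zero.2 (by decide)) hm
    (by decide) (fun x => or_iff_not_imp_left.2 isUnit_iff_ne_zero.2) (by decide)
    (by decide) (by decide)

theorem reduces_fortyOne : Reduces ⟨5, -5, 1⟩ := by
  have hm := Cubic.dvd_of_lift_eq_zero 41 37 (by decide) (m := ⟨5, -5, 1⟩) ⟨⟨-22, -47, -20⟩, by decide⟩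
    ⟨⟨25, 54, 23⟩, by decide⟩
  refine reduces_of_covers (W := [⟨⟨3, 0, -2⟩, ⟨0, 0, 0⟩, ⟨1, 0, -1⟩, ⟨0, 0, 0⟩⟩,
    ⟨⟨3, 0, -2⟩, ⟨0, 0, 0⟩, ⟨0, 0, 0⟩, ⟨1, 0, -1⟩⟩,
    ⟨⟨1, 0, -1⟩, ⟨2, 0, -1⟩, ⟨1, -1, 0⟩, ⟨0, 0, 0⟩⟩,
    ⟨⟨1, 0, -1⟩, ⟨2, 0, -1⟩, ⟨0, 0, 0⟩, ⟨1, -1, 0⟩⟩,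
    ⟨⟨3, -1, -1⟩, ⟨1, 0, -1⟩, ⟨-1, 2, -1⟩, ⟨0, 0, 0⟩⟩,
    ⟨⟨3, -1, -1⟩, ⟨1, 0, -1⟩, ⟨0, 0, 0⟩, ⟨-1, 2, -1⟩⟩,
    ⟨⟨3, 0, -2⟩, ⟨2, 0, -1⟩, ⟨1, -1, 0⟩, ⟨0, -1, 1⟩⟩,
    ⟨⟨3, 0, -2⟩, ⟨2, 0, -1⟩, ⟨-1, 1, 0⟩, ⟨0, 1, -1⟩⟩])
    (a := 0) (c := 9) (by decide +kernel) (by decide) (isUnit_iff_ne_zero.2 (by decide)) hm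
    (by decide) (fun x => or_iff_not_imp_left.2 isUnit_iff_ne_zero.2) (by decide)
    (by decide) (by decide)

theorem reduces_fortyThree : Reduces ⟨3, -3, 1⟩ := by
  have hm := Cubic.dvd_of_lift_eq_zero 43 8 (by decide) (m := ⟨3, -3, 1⟩) ⟨⟨-3, -3, -1⟩, by decide⟩
    ⟨⟨17, 20, 7⟩, by decide⟩
  refine reduces_of_covers (W := [⟨⟨1, -1, 0⟩, ⟨1, 0, 0⟩, ⟨0, 0, 0⟩, ⟨0, 0, 0⟩⟩,
    ⟨⟨1, 0, -1⟩, ⟨1, 0, 0⟩, ⟨1, -1, 0⟩, ⟨0, 0, 0⟩⟩,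
    ⟨⟨1, 0, -1⟩, ⟨1, 0, 0⟩, ⟨0, 0, 0⟩, ⟨1, -1, 0⟩⟩,
    ⟨⟨1, 0, -1⟩, ⟨1, -1, 0⟩, ⟨1, 0, -1⟩, ⟨0, 0, 0⟩⟩,
    ⟨⟨1, 0, -1⟩, ⟨1, -1, 0⟩, ⟨0, 0, 0⟩, ⟨1, 0, -1⟩⟩,
    ⟨⟨1, 0, -1⟩, ⟨0, 1, -1⟩, ⟨3, -1, -1⟩, ⟨0, 0, 0⟩⟩,
    ⟨⟨1, 0, -1⟩, ⟨0, 1, -1⟩, ⟨0, 0, 0⟩, ⟨3, -1, -1⟩⟩,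
    ⟨⟨2, 0, -1⟩, ⟨0, 1, -1⟩, ⟨1, 0, -1⟩, ⟨2, -1, 0⟩⟩])
    (a := 1) (c := 18) (by decide +kernel) (by decide) (isUnit_iff_ne_zero.2 (by decide)) hm
    (by decide) (fun x => or_iff_not_imp_left.2 isUnit_iff_ne_zero.2) (by decide)
    (by decide) (by decide)

/-- The prime 2 is inert, so the residue ring is the field 𝔽₈. -/
theorem reduces_two : Reduces ⟨2, 0, 0⟩ := by
  have hunit : ∀ x : Cubic (ZMod 2), x ≠ 0 → ∃ y, x * y = 1 := by decide
  refine reduces_of_covers (π := Cubic.red 2) (W := [⟨⟨-1, 0, 0⟩, ⟨0, 0, 0⟩, ⟨-1, 0, 0⟩, ⟨0, 0, 0⟩⟩,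
    ⟨⟨1, 0, -1⟩, ⟨1, -1, 0⟩, ⟨-1, 0, 0⟩, ⟨0, 0, 0⟩⟩])
    (a := 1) (c := 0) (by decide +kernel) (by decide)
    (.of_mul_eq_one 1 (by decide)) (Cubic.dvd_of_red_eq_zero 2) (by decide)
    (fun x => or_iff_not_imp_left.2 fun hx => ?_) (by decide) (by decide) (by decide)
  obtain ⟨y, hy⟩ := hunit x hx
  exact .of_mul_eq_one y hy

/-- The prime 3 is inert and -1 is not a square in 𝔽₂₇. -/
theorem dvd_sub_of_three_dvd (x y : Cubic ℤ) (h : (⟨3, 0, 0⟩ : Cubic ℤ) ∣ x ^ 2 + y ^ 2) :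
    (⟨3, 0, 0⟩ : Cubic ℤ) ∣ x ∧ (⟨3, 0, 0⟩ : Cubic ℤ) ∣ y := by
  have key : ∀ u v : Cubic (ZMod 3), u * u + v * v = 0 → u = 0 ∧ v = 0 := by decide +kernel
  obtain ⟨z, hz⟩ := h
  have h1 := congrArg (Cubic.red 3) hz
  rw [map_mul, show Cubic.red 3 ⟨3, 0, 0⟩ = 0 by decide, zero_mul, map_add, map_pow, map_pow,
    pow_two, pow_two] at h1
  exact (key _ _ h1).imp (Cubic.dvd_of_red_eq_zero 3 x) (Cubic.dvd_of_red_eq_zero 3 y)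

/-- The matrix splitting is not available at 3. Instead x² + xy + y² ≡ (x - y)² mod 3, so 3 ∣ N(g)
forces both differences to be divisible by 3. -/
theorem reduces_three : Reduces ⟨3, 0, 0⟩ := by
  intro g l hg
  have e3 : (⟨3, 0, 0⟩ : Cubic ℤ) = 3 := by decide
  obtain ⟨⟨s, hs⟩, ⟨t, ht⟩⟩ := dvd_sub_of_three_dvd (g.re - g.imI) (g.imJ - g.imK)
    ⟨l - g.re * g.imI - g.imJ * g.imK, by
      rw [nrm] at hg
      rw [e3] at hg ⊢
      linear_combination hg⟩
  rw [e3] at hs ht hg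
  -- This is the quotient of g by 1 + α on the right, where 1 + α has norm 3.
  refine .inl ⟨⟨g.imI + 2 * s, -s, t, g.imK + t⟩, ?_⟩
  rw [nrm] at hg ⊢
  have hx : g.re = g.imI + 3 * s := by linear_combination hs
  have hz : g.imJ = g.imK + 3 * t := by linear_combination ht
  rw [hx, hz] at hg
  apply mul_right_cancel₀ (show (3 : Cubic ℤ) ≠ 0 by decide)
  rw [← hg]
  dsimp only
  ring

instance : Fintype (TrivSqZeroExt (ZMod 7) (ZMod 7)) := inferInstanceAs (Fintype (ZMod 7 × ZMod 7))
instance : DecidableEq (TrivSqZeroExt (ZMod 7) (ZMod 7)) :=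
  inferInstanceAs (DecidableEq (ZMod 7 × ZMod 7))

/-- The square-zero extension `𝔽₇[ε]` is the residue ring modulo `ρ²`, with `φ = 2 - ε`. -/
def dualRoot : TrivSqZeroExt (ZMod 7) (ZMod 7) := (2, -1)

@[simp] theorem fst_dualRoot : dualRoot.fst = 2 := rfl
@[simp] theorem snd_dualRoot : dualRoot.snd = -1 := rfl

theorem dualRoot_root : dualRoot ^ 3 + dualRoot ^ 2 - 2 * dualRoot - 1 = 0 := by decide

theorem fst_lift_dualRoot (x : Cubic ℤ) : (Cubic.lift dualRoot dualRoot_root x).fst =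
    Cubic.lift ((2 : ℤ) : ZMod 7) (by decide) x := by
  simp [Cubic.lift_apply]

theorem rho_sq_dvd_of_lift_eq_zero (x : Cubic ℤ) (hx : Cubic.lift dualRoot dualRoot_root x = 0) :
    (⟨4, -4, 1⟩ : Cubic ℤ) ∣ x := by
  rw [Cubic.lift_apply] at hx
  have h1 : ((x.a + 2 * x.b + 4 * x.c : ℤ) : ZMod 7) = 0 := by
    have := congrArg TrivSqZeroExt.fst hx
    simp at this
    push_cast
    linear_combination this
  have h2 : ((x.b + 4 * x.c : ℤ) : ZMod 7) = 0 := by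
    have := congrArg TrivSqZeroExt.snd hx
    simp at this
    push_cast
    linear_combination -this
  obtain ⟨k, hk⟩ := (ZMod.intCast_zmod_eq_zero_iff_dvd _ 7).1 h1
  obtain ⟨n, hn⟩ := (ZMod.intCast_zmod_eq_zero_iff_dvd _ 7).1 h2
  have e7 : (⟨7, 0, 0⟩ : Cubic ℤ) = ⟨4, -4, 1⟩ * ⟨3, 5, 2⟩ := by decide
  -- Expansion of x in powers of ρ = 2 - φ: the constant and linear coefficients are divisible by 7,
  -- hence by ρ².
  have : x = ⟨7, 0, 0⟩ * (⟨k, 0, 0⟩ - ⟨n, 0, 0⟩ * ⟨2, -1, 0⟩) + ⟨4, -4, 1⟩ * ⟨x.c, 0, 0⟩ := by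
    push_cast at hk hn
    ext <;> simp <;> linarith
  rw [this, e7, mul_assoc]
  exact dvd_add (Dvd.intro _ rfl) (Dvd.intro _ rfl)

/-- Over 𝔽₇[ε] an absence of unit entries only makes g divisible by ρ; but then g = ρk and N(k) = l
at once. -/
theorem reduces_rho_sq : Reduces ⟨4, -4, 1⟩ := by
  refine reduces_of_covers_of_nonunit (π := Cubic.lift dualRoot dualRoot_root) (W := [⟨⟨1, 0, -1⟩, ⟨1, -1, 0⟩, ⟨1, -1, 0⟩, ⟨0, 0, 0⟩⟩,
    ⟨⟨1, 0, -1⟩, ⟨1, -1, 0⟩, ⟨0, 0, 0⟩, ⟨1, -1, 0⟩⟩,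
    ⟨⟨2, -2, 0⟩, ⟨1, -1, 0⟩, ⟨0, 0, 0⟩, ⟨0, 0, 0⟩⟩,
    ⟨⟨1, 0, -1⟩, ⟨2, 0, -1⟩, ⟨1, 0, -1⟩, ⟨0, 0, 0⟩⟩,
    ⟨⟨1, 0, -1⟩, ⟨2, 0, -1⟩, ⟨0, 0, 0⟩, ⟨1, 0, -1⟩⟩,
    ⟨⟨2, 0, -1⟩, ⟨0, 0, 0⟩, ⟨2, 0, -1⟩, ⟨-1, 1, 0⟩⟩,
    ⟨⟨2, 0, -1⟩, ⟨0, 0, 0⟩, ⟨1, -1, 0⟩, ⟨1, 1, -1⟩⟩,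
    ⟨⟨2, -2, 0⟩, ⟨0, 0, 0⟩, ⟨1, -1, 0⟩, ⟨1, -1, 0⟩⟩,
    ⟨⟨3, 1, -3⟩, ⟨2, -1, 0⟩, ⟨0, 0, 0⟩, ⟨0, 0, 0⟩⟩])
    (a := .inl 1) (c := .inl 3) (by decide +kernel) (by decide) (.of_mul_eq_one (.inl 5) (by decide))
    rho_sq_dvd_of_lift_eq_zero (by decide) (by decide) (by decide) reduces_rho ?_
  intro g l hg hu
  have h0 : splitMat 1 3 (mapOrder (Cubic.lift ((2 : ℤ) : ZMod 7) (by decide)) g) = 0 := by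
    ext i j
    have h := hu i j
    rw [TrivSqZeroExt.isUnit_iff_isUnit_fst, isUnit_iff_ne_zero, not_not] at h
    refine Eq.trans ?_ h
    fin_cases i <;> fin_cases j <;> simp [splitMat, mapOrder, fst_lift_dualRoot]
  obtain ⟨k, rfl⟩ := exists_eq_smul_of_mapOrder_eq_zero _
    (Cubic.dvd_of_lift_eq_zero 7 2 (by decide) (m := rho) ⟨-1, by decide⟩
      ⟨⟨4, 3, 1⟩, by decide⟩) g
    (eq_zero_of_splitMat_eq_zero (by decide) (isUnit_iff_ne_zero.2 (by decide)) _ h0)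
  refine .inl ⟨k, ?_⟩
  rw [nrm_smul, show (⟨4, -4, 1⟩ : Cubic ℤ) = rho ^ 2 by decide, mul_comm] at hg
  exact mul_right_cancel₀ (pow_ne_zero 2 (by decide)) hg

/-! ### Geometry of numbers and the finite list of short elements -/

open MeasureTheory in
/-- Minkowski's theorem for ellipsoids in even dimension. -/
theorem exists_int_vector_sum_sq_lt {ι : Type*} [Fintype ι] [DecidableEq ι] [Nonempty ι] {k : ℕ}
    (hk : Fintype.card ι = 2 * k) (A : Matrix ι ι ℝ) (hA : A.det ≠ 0)
    (h : |A.det| < Real.pi ^ k / (k.factorial : ℝ)) :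
    ∃ v : ι → ℤ, v ≠ 0 ∧ ∑ i, (A.mulVec fun j => (v j : ℝ)) i ^ 2 < 4 := by
  let b : Module.Basis ι ℝ (ι → ℝ) :=
    (Pi.basisFun ℝ ι).map (Matrix.toLinearEquiv' A (A.invertibleOfIsUnitDet hA.isUnit))
  have hb : ∀ v : ι → ℝ, ∑ j, v j • b j = A.mulVec v := fun v => by
    have h1 : A.mulVec v = Matrix.toLinearEquiv' A (A.invertibleOfIsUnitDet hA.isUnit) v := rfl
    have h2 : v = ∑ j, v j • Pi.basisFun ℝ ι j := ((Pi.basisFun ℝ ι).sum_repr v).symm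
    conv_rhs => rw [h1, h2, map_sum]
    simp [b]
  have hmat : Matrix.of b = A.transpose := by
    ext i j
    have h1 : b i = A.mulVec (Pi.basisFun ℝ ι i) := rfl
    rw [Matrix.of_apply, h1, Pi.basisFun_apply, Matrix.mulVec_single_one]
    rfl
  -- Radius 2 makes the volume 2^(2k) πᵏ/k!, cancelling the factor 2^(2k) in Minkowski's theorem.
  let s : Set (ι → ℝ) := {x | ∑ i, x i ^ 2 < 4}
  have hs : s = WithLp.toLp 2 ⁻¹' (Metric.ball (0 : EuclideanSpace ℝ ι) 2) := by
    ext x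
    simp only [s, Set.mem_ofPred_eq, Set.mem_preimage, mem_ball_zero_iff, EuclideanSpace.norm_eq]
    rw [Real.sqrt_lt' (by norm_num)]
    norm_num
  have hvol : volume s = ENNReal.ofReal (2 ^ (2 * k) * (Real.pi ^ k / (k.factorial : ℝ))) := by
    rw [hs, (PiLp.volume_preserving_toLp ι).measure_preimage
      Metric.isOpen_ball.measurableSet.nullMeasurableSet,
      InnerProductSpace.volume_ball_of_dim_even (k := k) (by simp [hk])]
    rw [finrank_euclideanSpace, hk, ENNReal.ofReal_mul (by positivity),
      ENNReal.ofReal_pow (by norm_num)]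
  have hconv : Convex ℝ s := by
    rw [hs]
    exact (convex_ball _ _).is_linear_preimage
      (IsLinearMap.mk (fun x y => rfl) (fun c x => rfl))
  have : Countable (Submodule.span ℤ (Set.range b)).toAddSubgroup :=
    inferInstanceAs (Countable (Submodule.span ℤ (Set.range b)))
  obtain ⟨⟨x, hx⟩, hx0, hxs⟩ := exists_ne_zero_mem_lattice_of_measure_mul_two_pow_lt_measure
    (ZSpan.isAddFundamentalDomain' b volume) (s := s) (fun x hx => by simpa [s] using hx) hconv (by
      rw [ZSpan.volume_fundamentalDomain, hmat, Matrix.det_transpose, hvol, Module.finrank_pi, hk,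
        mul_comm, ENNReal.ofReal_mul (by positivity), ENNReal.ofReal_pow (by norm_num)]
      norm_num
      gcongr
      · simp
      · exact (ENNReal.ofReal_lt_ofReal_iff (by positivity)).2 h)
  obtain ⟨v, rfl⟩ := (Submodule.mem_span_range_iff_exists_fun ℤ).1 hx
  have e : ∑ j, v j • b j = A.mulVec fun j => (v j : ℝ) := by
    rw [← hb]
    exact Finset.sum_congr rfl fun j _ => (Int.cast_smul_eq_zsmul ℝ _ _).symm
  refine ⟨v, ?_, ?_⟩
  · rintro rfl
    exact hx0 (Subtype.ext (by simp))
  · rw [← e]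
    exact hxs

namespace Cubic

/-- The trace. -/
def tr (x : Cubic ℤ) : ℤ := (x + conj x + conj (conj x)).a
/-- The second elementary symmetric function of the conjugates. -/
def sym (x : Cubic ℤ) : ℤ := (x * conj x + conj x * conj (conj x) + x * conj (conj x)).a
/-- The norm. -/
def norm (x : Cubic ℤ) : ℤ := (x * conj x * conj (conj x)).a

theorem tr_eq (x : Cubic ℤ) : tr x = 3 * x.a - x.b + 5 * x.c := by
  simp [tr, conj_apply]
  ring

end Cubic

/-- The units whose squares relate the short elements to the representatives, with inverses. -/
def unitPairs : List (Cubic ℤ × Cubic ℤ) :=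
  [(⟨0, 1, 0⟩, ⟨-2, 1, 1⟩), (⟨1, 0, 0⟩, ⟨1, 0, 0⟩), (⟨1, 0, -1⟩, ⟨1, -1, -1⟩),
    (⟨2, 1, 0⟩, ⟨0, -1, 1⟩), (⟨3, 0, -1⟩, ⟨1, 1, -1⟩), (⟨1, 2, 1⟩, ⟨3, -1, -1⟩),
    (⟨0, 2, 1⟩, ⟨-1, 1, 0⟩), (⟨1, 3, 1⟩, ⟨-7, 2, 3⟩), (⟨1, 1, 0⟩, ⟨2, 0, -1⟩),
    (⟨2, 0, -1⟩, ⟨1, 1, 0⟩), (⟨0, 1, 1⟩, ⟨-4, 1, 2⟩), (⟨1, 2, 0⟩, ⟨9, -2, -4⟩),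
    (⟨1, -1, -1⟩, ⟨1, 0, -1⟩)]

/-- Representatives of the short elements modulo squares of units and automorphisms. -/
def representatives : List (Cubic ℤ) :=
  [1, rho, ⟨2, 0, 0⟩, ⟨3, -2, 0⟩, ⟨3, 0, 0⟩, ⟨2, -2, 1⟩, ⟨5, -5, 1⟩, ⟨3, -3, 1⟩, ⟨4, -4, 1⟩]

theorem reduces_of_mem_representatives : ∀ m ∈ representatives, Reduces m := by
  simp only [representatives, List.forall_mem_cons, List.not_mem_nil, false_imp_iff, implies_true,
    and_true]
  exact ⟨reduces_one, reduces_rho, reduces_two, reduces_thirteen, reduces_three,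
    reduces_twentyNine, reduces_fortyOne, reduces_fortyThree, reduces_rho_sq⟩

/-- The parameters n, j - 5, k - 5 are the traces of m/ρ², mφ/ρ² and mφ'/ρ², with φ' = φ² - 2, and
determine m. Positive symmetric functions of the conjugates select the candidates. -/
theorem exists_representative : ∀ (n : Fin 4) (j k : Fin 11),
    let m : Cubic ℤ := ⟨-((j : ℤ) - 5) - 3 * ((k : ℤ) - 5), ((j : ℤ) - 5) - n, n + 2 * ((k : ℤ) - 5)⟩
    0 < m.tr → 0 < m.sym → 0 < m.norm → ∃ r ∈ representatives, ∃ e ∈ unitPairs,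
      m = r * e.1 ^ 2 ∨ m = Cubic.conj (r * e.1 ^ 2) ∨ m = Cubic.conj (Cubic.conj (r * e.1 ^ 2)) := by
  decide +kernel

theorem reduces_of_short (m : Cubic ℤ) (h1 : 0 < m.tr) (h2 : 0 < m.sym) (h3 : 0 < m.norm)
    (hn0 : 0 ≤ 2 * m.a + 2 * m.b + 3 * m.c) (hn3 : 2 * m.a + 2 * m.b + 3 * m.c ≤ 3)
    (hj : |2 * m.a + 3 * m.b + 3 * m.c| ≤ 5) (hk : |m.a + m.b + m.c| ≤ 5) : Reduces m := by
  have hu : ∀ e ∈ unitPairs, e.1 * e.2 = 1 := by decide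
  rw [abs_le] at hj hk
  have hm : m = ⟨-(((2 * m.a + 3 * m.b + 3 * m.c + 5).toNat : ℤ) - 5)
      - 3 * (((-(m.a + m.b + m.c) + 5).toNat : ℤ) - 5),
      (((2 * m.a + 3 * m.b + 3 * m.c + 5).toNat : ℤ) - 5) - (2 * m.a + 2 * m.b + 3 * m.c).toNat,
      (2 * m.a + 2 * m.b + 3 * m.c).toNat + 2 * (((-(m.a + m.b + m.c) + 5).toNat : ℤ) - 5)⟩ := by
    rw [Int.toNat_of_nonneg hn0, Int.toNat_of_nonneg (by omega), Int.toNat_of_nonneg (by omega)]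
    ext <;> simp only <;> ring
  have key := exists_representative ⟨(2 * m.a + 2 * m.b + 3 * m.c).toNat, by omega⟩
    ⟨(2 * m.a + 3 * m.b + 3 * m.c + 5).toNat, by omega⟩ ⟨(-(m.a + m.b + m.c) + 5).toNat, by omega⟩
  simp only at key
  rw [← hm] at key
  obtain ⟨r, hr, e, he, h⟩ := key h1 h2 h3
  have hred := (reduces_of_mem_representatives r hr).mul_unit_sq (hu e he)
  rcases h with h | h | h <;> rw [h]
  · exact hred
  · exact hred.conj
  · exact hred.conj.conj

section

variable (t : ℝ) (ht : t ^ 3 + t ^ 2 - 2 * t - 1 = 0)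

theorem sum_embed (x : Cubic ℤ) : ∑ i, embed t ht i x = x.tr := by
  simp only [Fin.sum_univ_three, embed, Cubic.lift_apply, Cubic.tr_eq]
  simp
  linear_combination 2 * x.c * t * ht

theorem embed_root_abs_lt (i : Fin 3) : |embed t ht i Cubic.gen| < 2 := by
  have h : embed t ht i Cubic.gen ^ 3 + embed t ht i Cubic.gen ^ 2 - 2 * embed t ht i Cubic.gen - 1
      = 0 := by
    have := congrArg (embed t ht i) Cubic.gen_root
    rwa [map_zero, map_sub, map_sub, map_add, map_pow, map_pow, map_mul, map_one,
      map_ofNat] at this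
  set s := embed t ht i Cubic.gen
  rw [abs_lt]
  constructor
  · by_contra! hs
    nlinarith [mul_nonneg_of_nonpos_of_nonpos (show s ≤ 0 by linarith) (show s + 2 ≤ 0 by linarith),
      mul_nonneg (mul_nonneg_of_nonpos_of_nonpos (show s ≤ 0 by linarith)
        (show s + 2 ≤ 0 by linarith)) (show 0 ≤ 1 - s by linarith)]
  · by_contra! hs
    nlinarith [mul_nonneg (sq_nonneg s) (show 0 ≤ s - 2 by linarith),
      mul_nonneg (show 0 ≤ s by linarith) (show 0 ≤ s - 2 by linarith)]

theorem norm_eq_embed (x : Cubic ℤ) : (x.norm : ℝ) = embed t ht 0 x * embed t ht 1 x * embed t ht 2 x := by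
  have h : x * Cubic.conj x * Cubic.conj (Cubic.conj x) = (x.norm : Cubic ℤ) := by
    rw [Cubic.intCast_eq]
    ext
    · rfl
    · simp [Cubic.conj_apply]
      ring
    · simp [Cubic.conj_apply]
      ring
  have h1 := congrArg (embed t ht 0) h
  rw [map_mul, map_mul, (embed_zero_conj t ht x).1, (embed_zero_conj t ht x).2, map_intCast] at h1
  exact h1.symm

theorem sym_eq_embed (x : Cubic ℤ) : (x.sym : ℝ) = embed t ht 0 x * embed t ht 1 x +
    embed t ht 1 x * embed t ht 2 x + embed t ht 0 x * embed t ht 2 x := by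
  have h : x * Cubic.conj x + Cubic.conj x * Cubic.conj (Cubic.conj x) + x * Cubic.conj (Cubic.conj x)
      = (x.sym : Cubic ℤ) := by
    rw [Cubic.intCast_eq]
    ext
    · rfl
    · simp [Cubic.conj_apply]
      ring
    · simp [Cubic.conj_apply]
      ring
  have h1 := congrArg (embed t ht 0) h
  rw [map_add, map_add, map_mul, map_mul, map_mul, (embed_zero_conj t ht x).1,
    (embed_zero_conj t ht x).2, map_intCast] at h1
  exact h1.symm

/-- The weights `(7 / ρ)²` generate `49` times the inverse different. -/
def weight : Cubic ℤ := ⟨4, 3, 1⟩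

/-- Since the weight is 7/ρ, this computes 49 Tr(x/ρ²): integrality of Tr(x/ρ²) reflects that 1/ρ²
lies in the inverse different. -/
theorem tr_weight_sq (x : Cubic ℤ) :
    (weight ^ 2 * x).tr = 49 * (2 * x.a + 2 * x.b + 3 * x.c) := by
  rw [Cubic.tr_eq, pow_two]
  simp [weight]
  ring

theorem tr_weight_sq_gen (x : Cubic ℤ) :
    (weight ^ 2 * x * Cubic.gen).tr = 49 * (2 * x.a + 3 * x.b + 3 * x.c) := by
  rw [Cubic.tr_eq, pow_two]
  simp [weight, Cubic.gen]
  ring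

theorem tr_weight_sq_conj_gen (x : Cubic ℤ) :
    (weight ^ 2 * x * Cubic.conj Cubic.gen).tr = -49 * (x.a + x.b + x.c) := by
  rw [Cubic.tr_eq, pow_two, Cubic.conj_apply]
  simp [weight, Cubic.gen]
  ring

theorem embed_conj_root_abs_lt (i : Fin 3) : |embed t ht i (Cubic.conj Cubic.gen)| < 2 := by
  have h : ∀ i : Fin 3, ∃ j : Fin 3, embed t ht i (Cubic.conj Cubic.gen) = embed t ht j Cubic.gen := by
    intro i
    fin_cases i
    · exact ⟨1, (embed_zero_conj t ht _).1⟩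
    · refine ⟨2, ?_⟩
      rw [← (embed_zero_conj t ht _).2]
      exact (embed_zero_conj t ht _).1.symm
    · refine ⟨0, ?_⟩
      have := (embed_zero_conj t ht (Cubic.conj Cubic.gen)).2
      rw [Cubic.conj_conj_conj] at this
      exact this.symm
  obtain ⟨j, hj⟩ := h i
  rw [hj]
  exact embed_root_abs_lt t ht j

theorem abs_sum_mul_lt {x y : Fin 3 → ℝ} (hx : ∀ i, 0 < x i) (hy : ∀ i, |y i| < 2) :
    |∑ i, x i * y i| < 2 * ∑ i, x i := by
  calc |∑ i, x i * y i| ≤ ∑ i, |x i * y i| := Finset.abs_sum_le_sum_abs _ _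
    _ < ∑ i, 2 * x i := Finset.sum_lt_sum_of_nonempty ⟨0, Finset.mem_univ _⟩ fun i _ => by
      rw [abs_mul, abs_of_pos (hx i), mul_comm]
      exact mul_lt_mul_of_pos_right (hy i) (hx i)
    _ = _ := by rw [Finset.mul_sum]

/-- The integer Tr(m/ρ²) is positive and below 4. The conjugates of φ lie in (-2, 2), so the traces
twisted by φ and φ' are less than 6 in absolute value, and m falls into the finite search. -/
theorem reduces_of_sum_lt (m : Cubic ℤ) (hm : ∀ i, 0 < embed t ht i m)
    (hs : ∑ i, embed t ht i (weight ^ 2 * m) < 4 * 49) : Reduces m := by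
  have hw : ∀ i, embed t ht i weight ≠ 0 := fun i h => by
    have h7 : weight * rho = 7 := by decide
    have := congrArg (embed t ht i) h7
    rw [map_mul, h, zero_mul, map_ofNat] at this
    norm_num at this
  have hpos : ∀ i, 0 < embed t ht i (weight ^ 2 * m) := fun i => by
    rw [map_mul, map_pow]
    exact mul_pos (by have := hw i; positivity) (hm i)
  have h0 := sum_embed t ht (weight ^ 2 * m)
  rw [tr_weight_sq] at h0
  have h1 := abs_sum_mul_lt hpos (embed_root_abs_lt t ht)
  have h2 := abs_sum_mul_lt hpos (embed_conj_root_abs_lt t ht)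
  simp only [← map_mul] at h1 h2
  rw [h0, sum_embed, tr_weight_sq_gen] at h1
  rw [h0, sum_embed, tr_weight_sq_conj_gen] at h2
  rw [h0] at hs
  have hs' : 49 * (2 * m.a + 2 * m.b + 3 * m.c) < 4 * 49 := by exact_mod_cast hs
  have h1' : |49 * (2 * m.a + 3 * m.b + 3 * m.c)| < 2 * (49 * (2 * m.a + 2 * m.b + 3 * m.c)) := by
    exact_mod_cast h1
  have h2' : |-49 * (m.a + m.b + m.c)| < 2 * (49 * (2 * m.a + 2 * m.b + 3 * m.c)) := by
    exact_mod_cast h2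
  rw [abs_lt] at h1' h2'
  have m0 := hm 0
  have m1 := hm 1
  have m2 := hm 2
  refine reduces_of_short m ?_ ?_ ?_ (by omega) (by omega) (by rw [abs_le]; omega)
    (by rw [abs_le]; omega)
  · have := sum_embed t ht m
    rw [Fin.sum_univ_three] at this
    have h : (0 : ℝ) < m.tr := by rw [← this]; positivity
    exact_mod_cast h
  · have h : (0 : ℝ) < m.sym := by rw [sym_eq_embed t ht]; positivity
    exact_mod_cast h
  · have h : (0 : ℝ) < m.norm := by rw [norm_eq_embed t ht]; positivity
    exact_mod_cast h

end

/-! ### The lattice of quaternions with norm divisible by l -/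

/-- A triangular square root of the norm form restricted to the lattice of all
`(l r₁ + s₁ u₁ - s₂ u₂) + (l r₂ + s₁ u₂ + s₂ (u₁ + u₂)) α + s₁ β + s₂ αβ`, scaled by `c`. -/
noncomputable def rootMat (c l u₁ u₂ : ℝ) : Matrix (Fin 4) (Fin 4) ℝ :=
  !![c * l, c * (l / 2), c * (u₁ + u₂ / 2), c * ((u₁ - u₂) / 2);
    0, c * (√3 / 2 * l), c * (√3 / 2 * u₂), c * (√3 / 2 * (u₁ + u₂));
    0, 0, c, c * (1 / 2);
    0, 0, 0, c * (√3 / 2)]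

theorem det_rootMat (c l u₁ u₂ : ℝ) : (rootMat c l u₁ u₂).det = c ^ 4 * l ^ 2 * (3 / 4) := by
  have h3 : √3 * √3 = (3 : ℝ) := Real.mul_self_sqrt (by norm_num)
  rw [Matrix.det_of_isUpperTriangular]
  · simp [rootMat, Fin.prod_univ_four]
    linear_combination c ^ 4 * l ^ 2 / 4 * h3
  · intro i j hij
    fin_cases i <;> fin_cases j <;> first | rfl | exact absurd hij (by decide)

theorem sum_sq_rootMat (c l u₁ u₂ : ℝ) (v : Fin 4 → ℝ) :
    ∑ k, (∑ j, rootMat c l u₁ u₂ k j * v j) ^ 2 = c ^ 2 *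
      ((l * v 0 + (v 2 * u₁ - v 3 * u₂)) ^ 2 + (l * v 0 + (v 2 * u₁ - v 3 * u₂)) *
        (l * v 1 + (v 2 * u₂ + v 3 * (u₁ + u₂))) + (l * v 1 + (v 2 * u₂ + v 3 * (u₁ + u₂))) ^ 2 +
        v 2 ^ 2 + v 2 * v 3 + v 3 ^ 2) := by
  have h3 : √3 * √3 = (3 : ℝ) := Real.mul_self_sqrt (by norm_num)
  simp only [Fin.sum_univ_four]
  simp [rootMat]
  linear_combination c ^ 2 / 4 * ((l * v 1 + (v 2 * u₂ + v 3 * (u₁ + u₂))) ^ 2 + v 3 ^ 2) * h3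

section

variable (t : ℝ) (ht : t ^ 3 + t ^ 2 - 2 * t - 1 = 0)

/-- The matrix of values of the integral basis at the real embeddings. -/
noncomputable def embedMat : Matrix (Fin 3) (Fin 3) ℝ :=
  Matrix.of fun i j => embed t ht i (![1, Cubic.gen, Cubic.gen * Cubic.gen] j)

theorem det_embedMat : (embedMat t ht).det = -7 := by
  rw [Matrix.det_fin_three]
  simp only [embedMat, Matrix.of_apply, embed, Cubic.lift_apply]
  simp [Cubic.gen]
  linear_combination ((-1) * t ^ 0 + (-9) * t ^ 1 + (1) * t ^ 2 + (2) * t ^ 3) * ht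

open scoped Kronecker in
/-- The matrix of the lattice in `ℝ¹²`. -/
noncomputable def latticeMat (c : Fin 3 → ℝ) (l u₁ u₂ : Cubic ℤ) :
    Matrix (Fin 4 × Fin 3) (Fin 4 × Fin 3) ℝ :=
  Matrix.blockDiagonal (fun i => rootMat (c i) (embed t ht i l) (embed t ht i u₁) (embed t ht i u₂))
    * ((1 : Matrix (Fin 4) (Fin 4) ℝ) ⊗ₖ embedMat t ht)

theorem embedMat_mulVec (v : Fin 3 → ℤ) (i : Fin 3) :
    (embedMat t ht).mulVec (fun j => (v j : ℝ)) i = embed t ht i ⟨v 0, v 1, v 2⟩ := by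
  rw [Cubic.eq_gen ⟨v 0, v 1, v 2⟩]
  simp [Matrix.mulVec, dotProduct, Fin.sum_univ_three, embedMat]
  ring

open scoped Kronecker in
theorem latticeMat_mulVec (c : Fin 3 → ℝ) (l u₁ u₂ : Cubic ℤ) (v : Fin 4 × Fin 3 → ℤ)
    (k : Fin 4) (i : Fin 3) :
    (latticeMat t ht c l u₁ u₂).mulVec (fun j => (v j : ℝ)) (k, i) =
      ∑ j, rootMat (c i) (embed t ht i l) (embed t ht i u₁) (embed t ht i u₂) k j *
        embed t ht i ⟨v (j, 0), v (j, 1), v (j, 2)⟩ := by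
  have h : ∀ j i, (((1 : Matrix (Fin 4) (Fin 4) ℝ) ⊗ₖ embedMat t ht).mulVec fun j => (v j : ℝ)) (j, i)
      = embed t ht i ⟨v (j, 0), v (j, 1), v (j, 2)⟩ := fun j i => by
    rw [← embedMat_mulVec t ht fun k => v (j, k)]
    simp [Matrix.mulVec, dotProduct, Fintype.sum_prod_type, Matrix.kroneckerMap_apply,
      Matrix.one_apply]
  rw [latticeMat, ← Matrix.mulVec_mulVec]
  conv_lhs => rw [Matrix.mulVec, dotProduct]
  simp [Fintype.sum_prod_type, Matrix.blockDiagonal_apply, h]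

theorem det_latticeMat_sq (c : Fin 3 → ℝ) (l u₁ u₂ : Cubic ℤ) :
    (latticeMat t ht c l u₁ u₂).det ^ 2 =
      (∏ i, c i ^ 4 * embed t ht i l ^ 2 * (3 / 4)) ^ 2 * 49 ^ 4 := by
  rw [latticeMat, Matrix.det_mul, Matrix.det_blockDiagonal, Matrix.det_kronecker]
  simp only [det_rootMat, Matrix.det_one, Fintype.card_fin, one_pow, one_mul]
  rw [mul_pow, det_embedMat t ht]
  norm_num

theorem embed_nrm_pos (h0 : Function.Injective (embed t ht 0)) {q : QuatOrder} (hq : q ≠ 0)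
    (i : Fin 3) : 0 < embed t ht i (nrm q) := by
  have hinj := embed_injective_of t ht (i := i) h0
  simp only [nrm, map_add, map_mul, map_pow]
  set x := embed t ht i q.re with hx
  set y := embed t ht i q.imI with hy
  set z := embed t ht i q.imJ with hz
  set w := embed t ht i q.imK with hw
  by_contra! hle
  have hy0 : y = 0 := by nlinarith [sq_nonneg (x + y / 2), sq_nonneg (z + w / 2), sq_nonneg w, sq_nonneg y]
  have hw0 : w = 0 := by nlinarith [sq_nonneg (x + y / 2), sq_nonneg (z + w / 2), sq_nonneg w, sq_nonneg y]
  have hx0 : x = 0 := by rw [hy0, hw0] at hle; nlinarith [sq_nonneg x, sq_nonneg z]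
  have hz0 : z = 0 := by rw [hy0, hw0] at hle; nlinarith [sq_nonneg x, sq_nonneg z]
  apply hq
  ext1
  · exact hinj (by rw [← hx, hx0]; simp)
  · exact hinj (by rw [← hy, hy0]; simp)
  · exact hinj (by rw [← hz, hz0]; simp)
  · exact hinj (by rw [← hw, hw0]; simp)

/-- The lattice consists of x + yα + (s₁ + s₂α)β with x + yα ≡ (s₁ + s₂α)(u₁ + u₂α) mod l. There the
norm is congruent to N(s₁ + s₂α)(N(u₁ + u₂α) + 1) ≡ 0. -/
theorem exists_short_multiple (h0 : Function.Injective (embed t ht 0)) (l u₁ u₂ : Cubic ℤ)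
    (hl : ∀ i, 0 < embed t ht i l) (hu : l ∣ u₁ ^ 2 + u₁ * u₂ + u₂ ^ 2 + 1) :
    ∃ (g : QuatOrder) (m : Cubic ℤ), nrm g = l * m ∧ (∀ i, 0 < embed t ht i m) ∧
      ∑ i, embed t ht i (weight ^ 2 * m) < 4 * 49 := by
  have hw : ∀ i, embed t ht i weight ≠ 0 := fun i h => by
    have h7 : weight * rho = 7 := by decide
    have := congrArg (embed t ht i) h7
    rw [map_mul, h, zero_mul, map_ofNat] at this
    norm_num at this
  -- The scaling turns the sum of squares into Tr(N(g)/(lρ²)) = Tr(m/ρ²).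
  set c : Fin 3 → ℝ := fun i => √((embed t ht i weight / 7) ^ 2 / embed t ht i l) with hc
  have hc2 : ∀ i, c i ^ 2 = (embed t ht i weight / 7) ^ 2 / embed t ht i l := fun i =>
    Real.sq_sqrt (div_nonneg (sq_nonneg _) (hl i).le)
  -- Both l and the discriminant cancel: N(ρ)⁻⁴ = 7⁻⁴ meets the covolume 7⁴ of ℤ[φ]⁴, leaving
  -- (3/4)³.
  have hdet : (latticeMat t ht c l u₁ u₂).det ^ 2 = (27 / 64) ^ 2 := by
    have hn := norm_eq_embed t ht weight
    have hn49 : weight.norm = 49 := by decide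
    rw [hn49] at hn
    have : ∀ i, c i ^ 4 * embed t ht i l ^ 2 * (3 / 4) = (embed t ht i weight / 7) ^ 4 * (3 / 4) :=
      fun i => by
        have := (hl i).ne'
        rw [show c i ^ 4 = (c i ^ 2) ^ 2 by ring, hc2]
        field_simp
    rw [det_latticeMat_sq, Finset.prod_congr rfl fun i _ => this i, Fin.prod_univ_three]
    calc _ = (embed t ht 0 weight * embed t ht 1 weight * embed t ht 2 weight) ^ 8 / 7 ^ 24
        * (27 / 64) ^ 2 * 49 ^ 4 := by ring
      _ = _ := by rw [← hn]; norm_num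
  have habs : |(latticeMat t ht c l u₁ u₂).det| = 27 / 64 := by
    rw [← abs_of_pos (show (0 : ℝ) < 27 / 64 by norm_num)]
    exact (sq_eq_sq_iff_abs_eq_abs _ _).1 hdet
  obtain ⟨v, hv0, hv⟩ := exists_int_vector_sum_sq_lt (k := 6) (by simp)
    (latticeMat t ht c l u₁ u₂) (fun h => by rw [h] at habs; norm_num at habs) (by
      rw [habs]
      -- Enough because 3⁶ = 729 exceeds 6! = 720.
      have : (3 : ℝ) ^ 6 ≤ Real.pi ^ 6 := pow_le_pow_left₀ (by norm_num) Real.pi_gt_three.le 6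
      norm_num [Nat.factorial]
      linarith)
  obtain ⟨d, hd⟩ := hu
  set e : Fin 4 → Cubic ℤ := fun j => ⟨v (j, 0), v (j, 1), v (j, 2)⟩ with he
  set g : QuatOrder := ⟨l * e 0 + (e 2 * u₁ - e 3 * u₂), l * e 1 + (e 2 * u₂ + e 3 * (u₁ + u₂)),
    e 2, e 3⟩ with hg
  obtain ⟨m, hm⟩ : l ∣ nrm g := by
    refine ⟨l * (e 0 ^ 2 + e 0 * e 1 + e 1 ^ 2) + (2 * e 0 + e 1) * (e 2 * u₁ - e 3 * u₂) +
      (e 0 + 2 * e 1) * (e 2 * u₂ + e 3 * (u₁ + u₂)) + d * (e 2 ^ 2 + e 2 * e 3 + e 3 ^ 2), ?_⟩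
    simp only [nrm, hg]
    linear_combination (e 2 ^ 2 + e 2 * e 3 + e 3 ^ 2) * hd
  have hl0 : l ≠ 0 := fun h => by
    have := hl 0
    rw [h, map_zero] at this
    exact lt_irrefl _ this
  have hg0 : g ≠ 0 := by
    intro h
    have h2 : e 2 = 0 := congrArg (·.imJ) h
    have h3 : e 3 = 0 := congrArg (·.imK) h
    have h00 : l * e 0 + (e 2 * u₁ - e 3 * u₂) = 0 := congrArg (·.re) h
    have h11 : l * e 1 + (e 2 * u₂ + e 3 * (u₁ + u₂)) = 0 := congrArg (·.imI) h
    rw [h2, h3] at h00 h11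
    have h0' : e 0 = 0 := (mul_eq_zero.1 (by linear_combination h00)).resolve_left hl0
    have h1' : e 1 = 0 := (mul_eq_zero.1 (by linear_combination h11)).resolve_left hl0
    have hall : ∀ j, e j = 0 := fun j => by fin_cases j <;> assumption
    apply hv0
    funext ⟨j, k⟩
    have := hall j
    fin_cases k
    · exact congrArg Cubic.a this
    · exact congrArg Cubic.b this
    · exact congrArg Cubic.c this
  refine ⟨g, m, hm, fun i => ?_, ?_⟩
  · have := embed_nrm_pos t ht h0 hg0 i
    rw [hm, map_mul] at this
    exact (mul_pos_iff_of_pos_left (hl i)).1 this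
  · have hsum : ∀ i, ∑ k, (latticeMat t ht c l u₁ u₂).mulVec (fun j => (v j : ℝ)) (k, i) ^ 2
        = embed t ht i (weight ^ 2 * m) / 49 := fun i => by
      have := (hl i).ne'
      simp only [latticeMat_mulVec]
      rw [sum_sq_rootMat (v := fun j => embed t ht i (e j)), hc2]
      have hmi := congrArg (embed t ht i) hm
      simp only [nrm, hg, map_add, map_mul, map_sub, map_pow] at hmi
      rw [hmi, map_mul, map_pow]
      field_simp
      ring
    rw [Fintype.sum_prod_type, Finset.sum_comm, Finset.sum_congr rfl fun i _ => hsum i,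
      ← Finset.sum_div] at hv
    linarith

end

/-! ### Solving u₁² + u₁u₂ + u₂² ≡ -1 modulo l -/

theorem exists_add_one_eq_zero {F : Type*} [Field F] [Finite F] (h3 : (3 : F) ≠ 0) :
    ∃ x y : F, x ^ 2 + x * y + y ^ 2 + 1 = 0 := by
  have := Fintype.ofFinite F
  by_cases h2 : ringChar F = 2
  · obtain ⟨x, hx⟩ := FiniteField.isSquare_of_char_two h2 (-1 : F)
    exact ⟨x, 0, by linear_combination -hx⟩
  · have h20 : (2 : F) ≠ 0 := Ring.two_ne_zero h2
    -- Completing the square with X = 2x + y turns the equation into X² + 3Y² + 4 = 0.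
    obtain ⟨X, Y, h⟩ := FiniteField.exists_root_sum_quadratic
      (f := (.C 1 * .X ^ 2 + .C 0 * .X + .C 0 : Polynomial F))
      (g := (.C 3 * .X ^ 2 + .C 0 * .X + .C 4 : Polynomial F))
      (Polynomial.degree_quadratic one_ne_zero) (Polynomial.degree_quadratic h3)
      (FiniteField.odd_card_of_char_ne_two h2)
    simp at h
    refine ⟨(X - Y) / 2, Y, ?_⟩
    field_simp
    linear_combination h

/-- Residue fields at primes not dividing 3 are finite, so each contains a solution; squarefreeness
allows gluing by the Chinese remainder theorem without lifting to prime powers. -/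
theorem exists_dvd_add_one {R : Type*} [CommRing R] [IsDomain R] [IsPrincipalIdealRing R]
    [Module.Free ℤ R] [Module.Finite ℤ R] (l : R) (hl : Squarefree l)
    (h3 : ∀ p, Prime p → p ∣ l → ¬p ∣ 3) : ∃ u₁ u₂ : R, l ∣ u₁ ^ 2 + u₁ * u₂ + u₂ ^ 2 + 1 := by
  induction l using UniqueFactorizationMonoid.induction_on_prime with
  | h₁ => exact absurd hl not_squarefree_zero
  | h₂ x hx => exact ⟨0, 0, hx.dvd⟩
  | h₃ a p _ hp ih =>
    obtain ⟨hrel, -, ha⟩ := squarefree_mul_iff.1 hl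
    obtain ⟨v₁, v₂, hv⟩ := ih ha fun q hq hqa => h3 q hq (hqa.mul_left p)
    have hne : Ideal.span {p} ≠ ⊥ := by simpa using hp.ne_zero
    have : (Ideal.span {p}).IsPrime := (Ideal.span_singleton_prime hp.ne_zero).2 hp
    have : (Ideal.span {p}).IsMaximal := this.isMaximal hne
    let _ := Ideal.Quotient.field (Ideal.span {p})
    have : Finite (R ⧸ Ideal.span {p}) := Ideal.finiteQuotientOfFreeOfNeBot _ hne
    obtain ⟨x, y, hxy⟩ := exists_add_one_eq_zero (F := R ⧸ Ideal.span {p}) fun h =>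
      h3 p hp (dvd_mul_right p a) (by
        rwa [← Ideal.mem_span_singleton, ← Ideal.Quotient.eq_zero_iff_mem, map_ofNat])
    obtain ⟨x, rfl⟩ := Ideal.Quotient.mk_surjective x
    obtain ⟨y, rfl⟩ := Ideal.Quotient.mk_surjective y
    replace hxy : p ∣ x ^ 2 + x * y + y ^ 2 + 1 := by
      rw [← Ideal.mem_span_singleton, ← Ideal.Quotient.eq_zero_iff_mem]
      simpa using hxy
    have hcop : IsCoprime p a := hrel.isCoprime
    obtain ⟨r, s, hrs⟩ := id hcop
    have hmod : ∀ c d e f : R, c ∣ d - e → c ∣ d ^ 2 + d * f + f ^ 2 + 1 →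
        c ∣ e ^ 2 + e * f + f ^ 2 + 1 := fun c d e f h h' => by
      have := dvd_sub h' (h.mul_right (d + e + f))
      convert this using 1
      ring
    have hmod' : ∀ c d e f g : R, c ∣ d - e → c ∣ f - g → c ∣ d ^ 2 + d * f + f ^ 2 + 1 →
        c ∣ e ^ 2 + e * g + g ^ 2 + 1 := fun c d e f g h h' h'' => by
      have := hmod c f g e h' (by convert hmod c d e f h h'' using 1; ring)
      convert this using 1
      ring
    refine ⟨x * (s * a) + v₁ * (r * p), y * (s * a) + v₂ * (r * p), hcop.mul_dvd ?_ ?_⟩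
    · refine hmod' p x _ y _ ⟨r * (x - v₁), ?_⟩ ⟨r * (y - v₂), ?_⟩ hxy
      · linear_combination -x * hrs
      · linear_combination -y * hrs
    · refine hmod' a v₁ _ v₂ _ ⟨s * (v₁ - x), ?_⟩ ⟨s * (v₂ - y), ?_⟩ hv
      · linear_combination -v₁ * hrs
      · linear_combination -v₂ * hrs

theorem Cubic.prime_three : Prime (3 : Cubic ℤ) := by
  refine ⟨by decide, fun h => ?_, fun x y hxy => ?_⟩
  · obtain ⟨x, hx⟩ := h.exists_right_inv
    have h1 := congrArg Cubic.a hx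
    rw [show (3 : Cubic ℤ) = ⟨3, 0, 0⟩ from rfl] at h1
    simp at h1
    omega
  · have key : ∀ u v : Cubic (ZMod 3), u * v = 0 → u = 0 ∨ v = 0 := by decide +kernel
    have h0 : Cubic.red 3 x * Cubic.red 3 y = 0 := by
      obtain ⟨d, hd⟩ := hxy
      rw [← map_mul, hd, map_mul, map_ofNat]
      exact zero_mul _
    exact (key _ _ h0).imp (Cubic.dvd_of_red_eq_zero 3 x) (Cubic.dvd_of_red_eq_zero 3 y)

/-! ### Every totally positive element is of the genus -/

section

variable (t : ℝ) (ht : t ^ 3 + t ^ 2 - 2 * t - 1 = 0)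

/-- Induction on divisibility removes a factor 3 or a square factor; otherwise the lattice argument
applies directly, without the induction hypothesis. -/
theorem inGenus_of_pos (h0 : Function.Injective (embed t ht 0)) (l : Cubic ℤ)
    (hl : ∀ i, 0 < embed t ht i l) : InGenus l := by
  induction l using (IsWellFounded.wf (r := DvdNotUnit (α := Cubic ℤ))).induction with
  | _ l ih =>
  have hl0 : l ≠ 0 := fun h => (hl 0).ne' (by rw [h, map_zero])
  by_cases h3 : (3 : Cubic ℤ) ∣ l
  · obtain ⟨m, rfl⟩ := h3
    have hm := ih m ⟨right_ne_zero_of_mul hl0, 3, Cubic.prime_three.not_isUnit, mul_comm _ _⟩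
      fun i => by
        have := hl i
        rw [map_mul, map_ofNat] at this
        exact (mul_pos_iff_of_pos_left three_pos).1 this
    -- The quaternion 1 + α has norm 3.
    exact hm.nrm_mul ⟨1, 1, 0, 0⟩
  by_cases hsq : Squarefree l
  · obtain ⟨u₁, u₂, hu⟩ := exists_dvd_add_one l hsq fun p hp hpl hp3 =>
      h3 ((hp.associated_of_dvd Cubic.prime_three hp3).dvd_iff_dvd_left.1 hpl)
    obtain ⟨g, m, hg, hm, hs⟩ := exists_short_multiple t ht h0 l u₁ u₂ hl hu
    exact reduces_of_sum_lt t ht m hm hs g l hg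
  · simp only [Squarefree, not_forall] at hsq
    obtain ⟨k, ⟨m, rfl⟩, hk⟩ := hsq
    rw [← sq] at *
    exact (ih m ⟨right_ne_zero_of_mul hl0, k ^ 2, mt (isUnit_pow_iff two_ne_zero).1 hk,
      mul_comm _ _⟩ fun i => by
        have := hl i
        rw [map_mul, map_pow] at this
        exact pos_of_mul_pos_right this (sq_nonneg _)).mul_sq k

end

/-! ### Transfer to Hamilton's quaternions -/

theorem normSq_quatOf (x y z w : ℝ) : Quaternion.normSq (quatOf x y z w) =
    x ^ 2 + x * y + y ^ 2 + z ^ 2 + z * w + w ^ 2 := by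
  have h : √3 * √3 = (3 : ℝ) := Real.mul_self_sqrt (by norm_num)
  rw [Quaternion.normSq_def', quatOf_re, quatOf_imI, quatOf_imJ, quatOf_imK]
  linear_combination (y ^ 2 + w ^ 2) / 4 * h

section

variable {ζ : ℂ} (hζ : IsPrimitiveRoot ζ 7)

/-- The embedding of the abstract order into Hamilton's quaternions. -/
noncomputable def toQuat (q : QuatOrder) : ℍ[ℝ] :=
  let f := Cubic.lift (traceReal ζ) (traceReal_root hζ)
  quatOf (f q.re) (f q.imI) (f q.imJ) (f q.imK)

theorem toQuat_add (p q : QuatOrder) : toQuat hζ (p + q) = toQuat hζ p + toQuat hζ q := by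
  simp only [toQuat, quatOf_add, QuaternionAlgebra.re_add, QuaternionAlgebra.imI_add,
    QuaternionAlgebra.imJ_add, QuaternionAlgebra.imK_add, map_add]

theorem toQuat_mul (p q : QuatOrder) : toQuat hζ (p * q) = toQuat hζ p * toQuat hζ q := by
  simp only [toQuat, quatOf_mul, QuaternionAlgebra.re_mul, QuaternionAlgebra.imI_mul,
    QuaternionAlgebra.imJ_mul, QuaternionAlgebra.imK_mul, map_add, map_sub, map_mul, map_neg,
    map_one]
  congr 1 <;> ring

theorem normSq_toQuat (q : QuatOrder) : Quaternion.normSq (toQuat hζ q) =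
    Cubic.lift (traceReal ζ) (traceReal_root hζ) (nrm q) := by
  simp only [toQuat, normSq_quatOf, nrm, map_add, map_mul, map_pow]

theorem exists_toQuat_eq (L : quatRing ζ) : ∃ q : QuatOrder, (L : ℍ[ℝ]) = toQuat hζ q := by
  obtain ⟨_, x, y, z, w, rfl⟩ := L
  refine ⟨⟨(cubicEquiv hζ).symm x, (cubicEquiv hζ).symm y, (cubicEquiv hζ).symm z,
    (cubicEquiv hζ).symm w⟩, ?_⟩
  simp only [toQuat, ← algebraMap_cubicEquiv hζ, RingEquiv.apply_symm_apply]

theorem coe_elt_cubicEquiv (x y z w : Cubic ℤ) :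
    (elt (cubicEquiv hζ x) (cubicEquiv hζ y) (cubicEquiv hζ z) (cubicEquiv hζ w) : ℍ[ℝ]) =
      toQuat hζ ⟨x, y, z, w⟩ := by
  simp only [elt, toQuat, algebraMap_cubicEquiv]

/-- Since γγ̄ = 7 = ρ(4 + 3φ + φ²), one has (aγ + ρb)γ̄ ∈ ρH. -/
theorem isIdealNorm_of_mem_idealS {P : quatRing ζ} (hP : P ∈ idealS hζ) {m : Cubic ℤ}
    (hN : Quaternion.normSq (P : ℍ[ℝ]) =
      algebraMap (𝓞 (realField ζ)) ℝ (rho7 hζ * cubicEquiv hζ m)) : IsIdealNorm m := by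
  obtain ⟨_, ha, _, hb, rfl⟩ := Submodule.mem_sup.1 hP
  obtain ⟨a, rfl⟩ := Ideal.mem_span_singleton'.1 ha
  obtain ⟨b, rfl⟩ := Ideal.mem_span_singleton'.1 hb
  obtain ⟨a', ha'⟩ := exists_toQuat_eq hζ a
  obtain ⟨b', hb'⟩ := exists_toQuat_eq hζ b
  have e1 : (elt 1 1 2 0 : quatRing ζ) = toQuat hζ gamma := by
    rw [gamma, ← coe_elt_cubicEquiv]
    congr 2 <;> simp [cubicEquiv_apply, Cubic.lift_apply]
  have e2 : (elt (rho7 hζ) 0 0 0 : quatRing ζ) = toQuat hζ ⟨rho, 0, 0, 0⟩ := by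
    rw [← coe_elt_cubicEquiv]
    congr 2 <;> simp [cubicEquiv_rho, rho]
  have e3 : (⟨rho, 0, 0, 0⟩ : QuatOrder) = rho • 1 := by ext1 <;> rfl
  have h7 : gamma * star gamma = rho • (⟨4, 3, 1⟩ : Cubic ℤ) • (1 : QuatOrder) := by ext1 <;> rfl
  refine ⟨a' * gamma + rho • b', (⟨4, 3, 1⟩ : Cubic ℤ) • a' + b' * star gamma, ?_, ?_⟩
  · rw [add_mul, mul_assoc, h7, smul_mul_assoc, smul_add, mul_smul_comm, mul_smul_comm, mul_one]
  · apply lift_traceReal_injective hζ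
    rw [← normSq_toQuat, ← algebraMap_cubicEquiv hζ, map_mul (cubicEquiv hζ), rho, cubicEquiv_rho,
      ← hN]
    congr 1
    simp only [Subring.coe_add, Subring.coe_mul, ha', hb', e1, e2, ← toQuat_mul, ← toQuat_add, e3,
      mul_smul_comm, mul_one]
    rfl

theorem represents_cubicEquiv {m : Cubic ℤ} :
    Represents (cubicEquiv hζ m) ↔ ∃ q : QuatOrder, nrm q = m := by
  constructor
  · rintro ⟨x, y, z, w, h⟩
    obtain ⟨x, rfl⟩ := (cubicEquiv hζ).surjective x
    obtain ⟨y, rfl⟩ := (cubicEquiv hζ).surjective y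
    obtain ⟨z, rfl⟩ := (cubicEquiv hζ).surjective z
    obtain ⟨w, rfl⟩ := (cubicEquiv hζ).surjective w
    refine ⟨⟨x, y, z, w⟩, (cubicEquiv hζ).injective ?_⟩
    rw [← h]
    simp only [nrm, map_add, map_mul, map_pow]
  · rintro ⟨q, rfl⟩
    refine ⟨cubicEquiv hζ q.re, cubicEquiv hζ q.imI, cubicEquiv hζ q.imJ, cubicEquiv hζ q.imK, ?_⟩
    simp only [nrm, map_add, map_mul, map_pow]

end

end QuatForm

theorem mainTheorem5 (ζ : ℂ) (hζ : IsPrimitiveRoot ζ 7)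
    (θ : NumberField.RingOfIntegers (QuatForm.realField ζ))
    (hθ : QuatForm.IsTotallyPositive θ)
    (hP : ∃ P ∈ QuatForm.idealS hζ,
      Quaternion.normSq (P : Quaternion ℝ)
        = algebraMap (NumberField.RingOfIntegers (QuatForm.realField ζ)) ℝ
            (QuatForm.rho7 hζ * θ))
    (hQ : QuatForm.Represents θ)
    (lam : NumberField.RingOfIntegers (QuatForm.realField ζ))
    (hlam : QuatForm.IsTotallyPositive lam) :
    QuatForm.Represents (lam * θ) := by
  open QuatForm in
  obtain ⟨m, rfl⟩ := (cubicEquiv hζ).surjective θ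
  obtain ⟨l, rfl⟩ := (cubicEquiv hζ).surjective lam
  obtain ⟨P, hPS, hPN⟩ := hP
  rw [← map_mul, represents_cubicEquiv]
  rcases inGenus_of_pos _ _ (lift_traceReal_injective hζ) l (embed_pos hζ l hlam) with ⟨q, hq⟩ | hl
  · obtain ⟨r, hr⟩ := (represents_cubicEquiv hζ).1 hQ
    exact ⟨q * r, by rw [QuatOrder.nrm_mul, hq, hr]⟩
  · exact exists_nrm_mul hl (isIdealNorm_of_mem_idealS hζ hPS hPN)
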